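/- **Setting.** Let $\mathcal L$ be a finite set, $T>0$. Let $\mathcal T_{\mathcal L}$ be the set of (non-planar) $\mathcal L$-labeled rooted trees, $|\tau|$ the number of vertices of $\tau$, $[\tau_1\cdots\tau_k]_a$ the tree obtained by joining the roots of $\tau_1,\dots,\tau_k$ to a new root with label $a$, and $\mathcal A\mathcal T_{\mathcal L}$ the commutative polynomial algebra over $\mathbb R$ generated by $\mathcal T_{\mathcal L}$. Its monomials $F=\tau_1\cdots\tau_k$ are the forests (including the empty forest $1$), with degree $|F|=\sum_i|\tau_i|$; $\mathcal A_n\mathcal T_{\mathcal L}$ is the span of the forests of degree $\le n$. The coproduct $\Delta:\mathcal A\mathcal T_{\mathcal L}\to\mathcal A\mathcal T_{\mathcal L}\otimes\mathcal A\mathcal T_{\mathcal L}$ is the algebra homomorphism with $\Delta([\tau_1\cdots\tau_k]_a)=1\otimes[\tau_1\cdots\tau_k]_a+(B_+^a\otimes\mathrm{id})\Delta(\tau_1\cdots\tau_k)$, where $B_+^a$ is linear with $B_+^a(\tau_1\cdots\tau_k)=[\tau_1\cdots\tau_k]_a$; the reduced coproduct is $\Delta'\sigma=\Delta\sigma-1\otimes\sigma-\sigma\otimes1$.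 Let $\mathcal C_2$ be the set of $g:[0,T]^2\to\mathbb R$ with $g_{tt}=0$, and $\mathcal C_3$ the set of $h:[0,T]^3\to\mathbb R$ with $h_{tts}=h_{tss}=0$. Put $(\delta g)_{tus}=g_{ts}-g_{tu}-g_{us}$, $\|g\|_\mu=\sup_{s,t}|g_{ts}|/|t-s|^\mu$, $\|h\|_{\rho,\rho'}=\sup_{s,u,t}|h_{tus}|/(|u-s|^{\rho}|t-u|^{\rho'})$ and $\|h\|_\mu=\inf\sum_i\|h_i\|_{\rho_i,\mu-\rho_i}$ over all sequences $h_i\in\mathcal C_3$, $\rho_i\in(0,\mu)$ with $h=\sum_ih_i$ pointwise. Let $\mathcal C_k^\mu=\{g\in\mathcal C_k:\|g\|_\mu<\infty\}$ and $\mathcal C_k^{1+}=\bigcup_{\mu>1}\mathcal C_k^\mu$ ($k=2,3$). For a linear map $X:\sigma\mapsto X^\sigma$ from $\mathcal A\mathcal T_{\mathcal L}$ to functions on $[0,T]^2$ write $X^{\sigma\otimes\rho}_{tus}=X^\sigma_{tu}X^\rho_{us}$, extended linearly. For $\gamma>0$ let $q_\gamma$ be the multiplicative function on forests with $q_\gamma(\tau)=1$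 for trees with $|\tau|\le1/\gamma$ and $q_\gamma(\tau)=\frac{1}{2^{\gamma|\tau|}-2}\sum q_\gamma(\tau^{(1)})q_\gamma(\tau^{(2)})$ for trees with $|\tau|>1/\gamma$, where $\Delta'\tau=\sum\tau^{(1)}\otimes\tau^{(2)}$. A *branched rough path (BRP) of roughness $\gamma$* is a unital algebra homomorphism $X$ from $\mathcal A\mathcal T_{\mathcal L}$ to $\mathcal C_2\oplus\mathbb R$ (constants adjoined, pointwise product) with $X^\tau\in\mathcal C_2$ for trees $\tau$, $\delta X^\sigma=X^{\Delta'\sigma}$ for all $\sigma\in\mathcal A\mathcal T_{\mathcal L}$, and $\|X^F\|_{\gamma|F|}\le BA^{|F|}q_\gamma(F)$ for all forests $F$, for some constants $A\ge0$, $B\in[0,1]$. Let $n\ge 0$ be an integer and $\gamma>1/(n+1)$. An *almost branched rough path* is a partial homomorphism $\widetilde X:\mathcal A_n\mathcal T_{\mathcal L}\to\mathcal C_2\oplus\mathbb R$ (linear, $\widetilde X^1=1$, $\widetilde X^{FG}=\widetilde X^F\widetilde X^G$ for forests with $|FG|\le n$, $\widetilde X^\tau\in\mathcal C_2$ for trees)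 such that, for all trees $\tau$ with $|\tau|\le n$, $R^\tau:=\delta\widetilde X^\tau-\widetilde X^{\Delta'\tau}\in\mathcal C_3^{1+}$, and $\max_{|\tau|\le n}\|\widetilde X^\tau\|_{\gamma|\tau|}\le K$ for some constant $K$. **Theorem.** Let $\widetilde X$ be an almost branched rough path. 1. There is a unique branched rough path $X$ of roughness $\gamma$ such that $X^\tau-\widetilde X^\tau\in\mathcal C_2^{1+}$ for all trees $\tau$ with $|\tau|\le n$. 2. If moreover $R^\tau\in\mathcal C_3^{(n+1)\gamma}$ for all trees $\tau$ with $|\tau|\le n$, then there is a unique branched rough path $X$ of roughness $\gamma$ such that $$\max_{\tau\in\mathcal T_{\mathcal L},\ |\tau|\le n}\|X^\tau-\widetilde X^\tau\|_{(n+1)\gamma}<\infty .$$ -/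

import Mathlib

open scoped TensorProduct ENNReal

noncomputable section

namespace BRP

/-! ### Labeled rooted trees and forests -/

/-- Planar (ordered) forests with vertices labeled by `L`, in the encoding
"root label of the first tree, forest above that root, remaining trees". -/
inductive PlanarForest (L : Type*) where
  | nil : PlanarForest L
  | cons (a : L) (children rest : PlanarForest L) : PlanarForest L

/-- Two planar forests are equivalent if they differ by reordering the branches at any
vertex and the trees of the forest. -/
inductive PlanarForest.Equiv {L : Type*} : PlanarForest L → PlanarForest L → Prop where
  | refl (f) : Equiv f f
  | symm {f g} : Equiv f g → Equiv g f
  | trans {f g h} : Equiv f g → Equiv g h → Equiv f h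
  | cons (a) {f f' g g'} : Equiv f f' → Equiv g g' → Equiv (.cons a f g) (.cons a f' g')
  | swap (a f b g h) : Equiv (.cons a f (.cons b g h)) (.cons b g (.cons a f h))

instance PlanarForest.setoid (L : Type*) : Setoid (PlanarForest L) where
  r := PlanarForest.Equiv
  iseqv := ⟨.refl, .symm, .trans⟩

/-- Non-planar forests. -/
def Branches (L : Type*) : Type _ := Quotient (PlanarForest.setoid L)

/-- An `L`-labeled rooted tree (branches are unordered): the label of the root together with
the non-planar forest growing above the root. See `LTree.equivNode`, which identifies trees
with pairs (label, multiset of trees). -/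
@[ext]
structure LTree (L : Type*) where
  root : L
  above : Branches L

variable {L : Type*}

/-- The number of vertices of a planar forest. -/
def PlanarForest.size : PlanarForest L → ℕ
  | .nil => 0
  | .cons _ f g => 1 + f.size + g.size

theorem PlanarForest.Equiv.size_eq {f g : PlanarForest L} (h : Equiv f g) :
    f.size = g.size := by
  induction h with
  | refl => rfl
  | symm _ ih => exact ih.symm
  | trans _ _ ih₁ ih₂ => exact ih₁.trans ih₂
  | cons a _ _ ih₁ ih₂ => simp [PlanarForest.size, ih₁, ih₂]
  | swap => simp only [PlanarForest.size]; omega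

/-- The multiset of trees of a planar forest. -/
def PlanarForest.toMultiset : PlanarForest L → Multiset (LTree L)
  | .nil => 0
  | .cons a f g => ⟨a, Quotient.mk _ f⟩ ::ₘ g.toMultiset

theorem PlanarForest.Equiv.toMultiset_eq {f g : PlanarForest L} (h : Equiv f g) :
    f.toMultiset = g.toMultiset := by
  induction h with
  | refl => rfl
  | symm _ ih => exact ih.symm
  | trans _ _ ih₁ ih₂ => exact ih₁.trans ih₂
  | @cons a f f' g g' h₁ _ _ ih₂ =>
    have : (Quotient.mk _ f : Branches L) = Quotient.mk _ f' := Quotient.sound h₁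
    simp [PlanarForest.toMultiset, ih₂, this]
  | swap => simp only [PlanarForest.toMultiset]; exact Multiset.cons_swap _ _ _

/-- The multiset of trees of a non-planar forest. -/
def Branches.toMultiset : Branches L → Multiset (LTree L) :=
  Quotient.lift PlanarForest.toMultiset fun _ _ h => h.toMultiset_eq

/-- The empty forest. -/
def Branches.nil : Branches L := Quotient.mk _ .nil

/-- Adding a tree to a non-planar forest. -/
def Branches.add (τ : LTree L) (F : Branches L) : Branches L :=
  Quotient.map₂ (PlanarForest.cons τ.root) (fun _ _ h _ _ h' => .cons _ h h') τ.above F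

instance : LeftCommutative (Branches.add (L := L)) where
  left_comm := by
    rintro ⟨a, ⟨f⟩⟩ ⟨b, ⟨g⟩⟩ ⟨h⟩
    exact Quotient.sound (.swap a f b g h)

/-- The non-planar forest made of a given multiset of trees. -/
def Branches.ofMultiset (F : Multiset (LTree L)) : Branches L :=
  F.foldr Branches.add Branches.nil

theorem Branches.toMultiset_add (τ : LTree L) (F : Branches L) :
    (Branches.add τ F).toMultiset = τ ::ₘ F.toMultiset := by
  obtain ⟨a, ⟨f⟩⟩ := τ
  obtain ⟨g⟩ := F
  rfl

theorem Branches.toMultiset_ofMultiset (F : Multiset (LTree L)) :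
    (ofMultiset F).toMultiset = F := by
  induction F using Multiset.induction_on with
  | empty => rfl
  | cons τ F ih =>
    rw [ofMultiset, Multiset.foldr_cons, toMultiset_add]
    exact congrArg _ ih

theorem Branches.ofMultiset_toMultiset (F : Branches L) : ofMultiset F.toMultiset = F := by
  obtain ⟨f⟩ := F
  induction f with
  | nil => rfl
  | cons a f g _ ih =>
    change ofMultiset ((⟨a, Quotient.mk _ f⟩ : LTree L) ::ₘ g.toMultiset) = _
    rw [ofMultiset, Multiset.foldr_cons]
    exact congrArg (Branches.add _) ih

/-- The tree `[τ₁ ⋯ τₖ]_a` obtained by attaching the roots of `τ₁, …, τₖ` to a new root with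
label `a`. -/
def LTree.node (a : L) (F : Multiset (LTree L)) : LTree L := ⟨a, Branches.ofMultiset F⟩

/-- The multiset of trees `τ₁, …, τₖ` such that `τ = [τ₁ ⋯ τₖ]_a`. -/
def LTree.branches (τ : LTree L) : Multiset (LTree L) := τ.above.toMultiset

@[simp] theorem LTree.root_node (a : L) (F : Multiset (LTree L)) : (node a F).root = a := rfl

@[simp] theorem LTree.branches_node (a : L) (F : Multiset (LTree L)) :
    (node a F).branches = F := Branches.toMultiset_ofMultiset F

@[simp] theorem LTree.node_branches (τ : LTree L) : node τ.root τ.branches = τ := by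
  ext
  · rfl
  · exact Branches.ofMultiset_toMultiset _

/-- A labeled rooted tree is the same thing as a label and a multiset of labeled rooted
trees. -/
def LTree.equivNode : LTree L ≃ L × Multiset (LTree L) where
  toFun τ := (τ.root, τ.branches)
  invFun p := node p.1 p.2
  left_inv := node_branches
  right_inv p := by simp

/-- The number `|τ|` of vertices of a tree. -/
def LTree.degree (τ : LTree L) : ℕ :=
  1 + Quotient.lift PlanarForest.size (fun _ _ h => PlanarForest.Equiv.size_eq h) τ.above

/-- The degree `|τ₁ ⋯ τₖ| = |τ₁| + ⋯ + |τₖ|` of a forest. -/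
def forestDegree (F : Multiset (LTree L)) : ℕ := (F.map LTree.degree).sum

theorem LTree.degree_eq (τ : LTree L) : τ.degree = 1 + forestDegree τ.branches := by
  obtain ⟨a, ⟨f⟩⟩ := τ
  change 1 + f.size = 1 + forestDegree f.toMultiset
  congr 1
  induction f with
  | nil => rfl
  | cons b f g _ ih =>
    simp only [PlanarForest.size, PlanarForest.toMultiset, forestDegree, Multiset.map_cons,
      Multiset.sum_cons]
    rw [ih]
    rfl

theorem LTree.degree_node (a : L) (F : Multiset (LTree L)) :
    (node a F).degree = 1 + forestDegree F := by
  simp [degree_eq]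

theorem LTree.degree_lt_of_mem {σ τ : LTree L} (h : σ ∈ τ.branches) : σ.degree < τ.degree := by
  rw [τ.degree_eq, Nat.lt_one_add_iff]
  exact Multiset.single_le_sum (fun _ _ => Nat.zero_le _) _ (Multiset.mem_map_of_mem _ h)

/-! ### The algebra of forests and its coproduct -/

/-- The commutative polynomial algebra over `ℝ` generated by the `L`-labeled rooted trees. -/
abbrev TreeAlg (L : Type*) : Type _ := MvPolynomial (LTree L) ℝ

/-- A tree as an element of the algebra. -/
abbrev ofTree (τ : LTree L) : TreeAlg L := MvPolynomial.X τ

/-- The forest (monomial) `τ₁ ⋯ τₖ`. The empty forest is the unit. -/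
def ofForest (F : Multiset (LTree L)) : TreeAlg L := (F.map ofTree).prod

/-- The linear map `B₊^a` with `B₊^a(τ₁ ⋯ τₖ) = [τ₁ ⋯ τₖ]_a`. -/
def Bplus (a : L) : TreeAlg L →ₗ[ℝ] TreeAlg L :=
  (MvPolynomial.basisMonomials (LTree L) ℝ).constr ℝ
    fun m => ofTree (LTree.node a (Finsupp.toMultiset m))

theorem Bplus_ofForest (a : L) (F : Multiset (LTree L)) :
    Bplus a (ofForest F) = ofTree (LTree.node a F) := by
  classical
  have h : ofForest F = MvPolynomial.basisMonomials (LTree L) ℝ (Multiset.toFinsupp F) := by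
    rw [MvPolynomial.coe_basisMonomials]
    induction F using Multiset.induction_on with
    | empty => simp [ofForest]
    | cons τ F ih =>
      have h₁ : ofForest (τ ::ₘ F) = ofTree τ * ofForest F := by simp [ofForest]
      rw [h₁, ih, ← Multiset.singleton_add, map_add, Multiset.toFinsupp_singleton]
      exact (MvPolynomial.monomial_mul (s := Finsupp.single τ 1) (a := (1 : ℝ))
        (s' := Multiset.toFinsupp F) (b := 1)).trans (by rw [one_mul])
  rw [h, Bplus, Module.Basis.constr_basis, Multiset.toFinsupp_toMultiset]

/-- The coproduct on trees: for `τ = [τ₁ ⋯ τₖ]_a`,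
`Δ τ = 1 ⊗ τ + (B₊^a ⊗ id) (Δ τ₁ ⋯ Δ τₖ)`. -/
def treeCoproduct (τ : LTree L) : TreeAlg L ⊗[ℝ] TreeAlg L :=
  1 ⊗ₜ ofTree τ +
    TensorProduct.map (Bplus τ.root) LinearMap.id
      (τ.branches.attach.map fun σ => treeCoproduct σ.1).prod
termination_by τ.degree
decreasing_by exact LTree.degree_lt_of_mem σ.2

/-- The coproduct `Δ`, an algebra homomorphism. -/
def coproduct : TreeAlg L →ₐ[ℝ] TreeAlg L ⊗[ℝ] TreeAlg L := MvPolynomial.aeval treeCoproduct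

/-- The recursion `Δ τ = 1 ⊗ τ + (B₊^a ⊗ id) Δ (B₋^a τ)` for a tree `τ` with root label `a`. -/
theorem coproduct_node (a : L) (F : Multiset (LTree L)) :
    coproduct (ofTree (LTree.node a F)) =
      1 ⊗ₜ ofTree (LTree.node a F) +
        TensorProduct.map (Bplus a) LinearMap.id (coproduct (ofForest F)) := by
  have h : coproduct (ofForest F) = (F.map treeCoproduct).prod := by
    rw [ofForest, map_multiset_prod, Multiset.map_map]
    simp [coproduct, Function.comp_def]
  rw [h, coproduct, MvPolynomial.aeval_X, treeCoproduct,
    Multiset.attach_map_val' _ treeCoproduct, LTree.branches_node, LTree.root_node]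

/-- The reduced coproduct `Δ' σ = Δ σ - 1 ⊗ σ - σ ⊗ 1`. -/
def reducedCoproduct : TreeAlg L →ₗ[ℝ] TreeAlg L ⊗[ℝ] TreeAlg L :=
  coproduct.toLinearMap - TensorProduct.mk ℝ (TreeAlg L) (TreeAlg L) 1
    - (TensorProduct.mk ℝ (TreeAlg L) (TreeAlg L)).flip 1

theorem reducedCoproduct_apply (σ : TreeAlg L) :
    reducedCoproduct σ = coproduct σ - 1 ⊗ₜ σ - σ ⊗ₜ 1 := rfl

/-- All terms of `Δ' (τ₁ ⋯ τₖ)`, `k ≥ 1`, are tensor products of two nonempty forests whose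
degrees sum up to the degree of `τ₁ ⋯ τₖ`. -/
theorem reducedCoproduct_ofForest_mem (F : Multiset (LTree L)) (hF : F ≠ 0) :
    reducedCoproduct (ofForest F) ∈ Submodule.span ℝ
      {z | ∃ G H : Multiset (LTree L), G ≠ 0 ∧ H ≠ 0 ∧
        forestDegree G + forestDegree H = forestDegree F ∧ ofForest G ⊗ₜ ofForest H = z} := by
  induction hd : forestDegree F using Nat.strong_induction_on generalizing F with
  | _ d ih =>
  subst hd
  obtain ⟨τ, hτF⟩ := Multiset.exists_mem_of_ne_zero hF
  obtain ⟨F, rfl⟩ := Multiset.exists_cons_of_mem hτF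
  have hτ : 0 < τ.degree := by rw [τ.degree_eq]; omega
  have hsplit : ∀ G H : Multiset (LTree L), ofForest (G + H) = ofForest G * ofForest H := by
    intro G H; simp [ofForest]
  have hdeg : ∀ G H : Multiset (LTree L),
      forestDegree (G + H) = forestDegree G + forestDegree H := by
    intro G H; simp [forestDegree]
  have h1 : ∀ σ : LTree L, ofForest {σ} = ofTree σ := by intro σ; simp [ofForest]
  have hd1 : ∀ σ : LTree L, forestDegree {σ} = σ.degree := by intro σ; simp [forestDegree]
  have hpos : ∀ G : Multiset (LTree L), G ≠ 0 → 0 < forestDegree G := by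
    intro G hG
    obtain ⟨σ, hσ⟩ := Multiset.exists_mem_of_ne_zero hG
    obtain ⟨G, rfl⟩ := Multiset.exists_cons_of_mem hσ
    rw [← Multiset.singleton_add, hdeg, hd1, σ.degree_eq]; omega
  by_cases hF0 : F = 0
  · subst hF0
    obtain ⟨a, B, rfl⟩ : ∃ a B, τ = LTree.node a B := ⟨_, _, τ.node_branches.symm⟩
    rw [show (LTree.node a B ::ₘ 0 : Multiset (LTree L)) = {LTree.node a B} from rfl, h1, hd1,
      reducedCoproduct_apply, coproduct_node, LTree.degree_node]
    by_cases hB : B = 0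
    · subst hB
      have : coproduct (ofForest (0 : Multiset (LTree L))) = 1 ⊗ₜ ofForest 0 := by
        simp [ofForest, Algebra.TensorProduct.one_def]
      rw [this, TensorProduct.map_tmul,
        show (1 : TreeAlg L) = ofForest 0 by simp [ofForest], Bplus_ofForest]
      simp
    · have hw := ih (forestDegree B) (by
        rw [show (LTree.node a B ::ₘ 0 : Multiset (LTree L)) = {LTree.node a B} from rfl, hd1,
          LTree.degree_node]; omega) B hB rfl
      have he : coproduct (ofForest B) =
          reducedCoproduct (ofForest B) + 1 ⊗ₜ ofForest B + ofForest B ⊗ₜ 1 := by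
        rw [reducedCoproduct_apply]; abel
      have hone : Bplus a 1 = ofForest {LTree.node a 0} := by
        rw [show (1 : TreeAlg L) = ofForest 0 by simp [ofForest], Bplus_ofForest, h1]
      rw [he, map_add, map_add, TensorProduct.map_tmul, TensorProduct.map_tmul, Bplus_ofForest,
        hone, LinearMap.id_apply, LinearMap.id_apply]
      have : ∀ x y z w : TreeAlg L ⊗[ℝ] TreeAlg L, x + (y + z + w) - x - w = y + z := by
        intros; abel
      rw [this]
      refine Submodule.add_mem _ ?_ (Submodule.subset_span
        ⟨{LTree.node a 0}, B, by simp, hB, by simp [hd1, LTree.degree_node, forestDegree], rfl⟩)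
      rw [← Submodule.mem_comap]
      refine Submodule.span_le.2 ?_ hw
      rintro _ ⟨G, H, hG, hH, hGH, rfl⟩
      refine Submodule.subset_span ⟨{LTree.node a G}, H, by simp, hH, ?_, ?_⟩
      · rw [hd1, LTree.degree_node]; omega
      · rw [TensorProduct.map_tmul, Bplus_ofForest, h1]; rfl
  · have hF' := hpos F hF0
    rw [← Multiset.singleton_add, hdeg, hd1] at *
    have hA := ih τ.degree (by omega) {τ} (by simp) (hd1 τ)
    have hB := ih (forestDegree F) (by omega) F hF0 rfl
    rw [hsplit]
    generalize hx : ofForest ({τ} : Multiset (LTree L)) = x at *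
    have key : reducedCoproduct (x * ofForest F) =
        reducedCoproduct x * reducedCoproduct (ofForest F)
        + (1 ⊗ₜ ofForest F * reducedCoproduct x + ofForest F ⊗ₜ 1 * reducedCoproduct x)
        + (1 ⊗ₜ x * reducedCoproduct (ofForest F) + x ⊗ₜ 1 * reducedCoproduct (ofForest F))
        + (x ⊗ₜ ofForest F + ofForest F ⊗ₜ x) := by
      have e1 : x ⊗ₜ[ℝ] ofForest F = (x ⊗ₜ 1) * (1 ⊗ₜ ofForest F) := by simp
      have e2 : ofForest F ⊗ₜ[ℝ] x = (1 ⊗ₜ x) * (ofForest F ⊗ₜ 1) := by simp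
      have e3 : (1 : TreeAlg L) ⊗ₜ[ℝ] (x * ofForest F) = (1 ⊗ₜ x) * (1 ⊗ₜ ofForest F) := by simp
      have e4 : (x * ofForest F) ⊗ₜ[ℝ] (1 : TreeAlg L) = (x ⊗ₜ 1) * (ofForest F ⊗ₜ 1) := by simp
      simp only [reducedCoproduct_apply, map_mul, e1, e2, e3, e4]
      ring
    have hone : (1 : TreeAlg L) = ofForest 0 := by simp [ofForest]
    rw [key]
    have mulmem : ∀ {p q : TreeAlg L ⊗[ℝ] TreeAlg L} {S U V : Set (TreeAlg L ⊗[ℝ] TreeAlg L)},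
        p ∈ Submodule.span ℝ S → q ∈ Submodule.span ℝ U → (∀ s ∈ S, ∀ u ∈ U, s * u ∈ V) →
        p * q ∈ Submodule.span ℝ V := by
      intro p q S U V hp hq h
      have := Submodule.mul_mem_mul hp hq
      rw [Submodule.span_mul_span] at this
      refine Submodule.span_mono ?_ this
      rintro _ ⟨s, hs, u, hu, rfl⟩
      exact h s hs u hu
    have hsing : ∀ p : TreeAlg L ⊗[ℝ] TreeAlg L, p ∈ Submodule.span ℝ {p} :=
      fun p => Submodule.subset_span rfl
    have hz : forestDegree (0 : Multiset (LTree L)) = 0 := rfl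
    have hxd := hd1 τ
    refine Submodule.add_mem _ (Submodule.add_mem _ (Submodule.add_mem _ ?_ ?_) ?_) ?_
    · refine mulmem hA hB ?_
      rintro _ ⟨G, H, hG, hH, hGH, rfl⟩ _ ⟨G', H', hG', hH', hGH', rfl⟩
      exact ⟨G + G', H + H', by simp [hG], by simp [hH], by rw [hdeg, hdeg]; omega,
        by rw [hsplit, hsplit, Algebra.TensorProduct.tmul_mul_tmul]⟩
    · refine Submodule.add_mem _ (mulmem (hsing _) hA ?_) (mulmem (hsing _) hA ?_)
      · rintro _ rfl _ ⟨G, H, hG, hH, hGH, rfl⟩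
        exact ⟨0 + G, F + H, by simp [hG], by simp [hH], by rw [hdeg, hdeg]; omega,
          by rw [hsplit, hsplit, ← hone, Algebra.TensorProduct.tmul_mul_tmul]⟩
      · rintro _ rfl _ ⟨G, H, hG, hH, hGH, rfl⟩
        exact ⟨F + G, 0 + H, by simp [hG], by simp [hH], by rw [hdeg, hdeg]; omega,
          by rw [hsplit, hsplit, ← hone, Algebra.TensorProduct.tmul_mul_tmul]⟩
    · refine Submodule.add_mem _ (mulmem (hsing _) hB ?_) (mulmem (hsing _) hB ?_)
      · rintro _ rfl _ ⟨G, H, hG, hH, hGH, rfl⟩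
        exact ⟨0 + G, {τ} + H, by simp [hG], by simp [hH], by rw [hdeg, hdeg]; omega,
          by rw [hsplit, hsplit, ← hone, hx, Algebra.TensorProduct.tmul_mul_tmul]⟩
      · rintro _ rfl _ ⟨G, H, hG, hH, hGH, rfl⟩
        exact ⟨{τ} + G, 0 + H, by simp [hG], by simp [hH], by rw [hdeg, hdeg]; omega,
          by rw [hsplit, hsplit, ← hone, hx, Algebra.TensorProduct.tmul_mul_tmul]⟩
    · refine Submodule.add_mem _ (Submodule.subset_span ⟨{τ}, F, by simp, hF0, ?_, by rw [hx]⟩)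
        (Submodule.subset_span ⟨F, {τ}, hF0, by simp, ?_, by rw [hx]⟩) <;> omega

/-! ### The function `q_γ` -/

/-- The function `q_γ` on trees: `q_γ(τ) = 1` if `|τ| ≤ 1/γ`, and
`q_γ(τ) = (2^{γ|τ|} - 2)⁻¹ ∑' q_γ(τ⁽¹⁾) q_γ(τ⁽²⁾)` otherwise, where `q_γ` is multiplicative on
forests and the sum is over the terms of `Δ' τ`. The test on degrees only serves to make the
recursion well-founded: all the trees in `Δ' τ` have degree less than `|τ|`, and
`qTree_of_lt` below is the recursion without this test. -/
def qTree (γ : ℝ) (τ : LTree L) : ℝ :=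
  if γ * τ.degree ≤ 1 then 1
  else ((2 : ℝ) ^ (γ * τ.degree) - 2)⁻¹ *
    Algebra.TensorProduct.productMap
      (MvPolynomial.aeval fun σ : LTree L =>
        if _h : σ.degree < τ.degree then qTree γ σ else 0)
      (MvPolynomial.aeval fun σ : LTree L =>
        if _h : σ.degree < τ.degree then qTree γ σ else 0)
      (reducedCoproduct (ofTree τ))
termination_by τ.degree

/-- The multiplicative extension of `q_γ` to forests. -/
def qForest (γ : ℝ) (F : Multiset (LTree L)) : ℝ := (F.map (qTree γ)).prod

theorem qTree_of_le (γ : ℝ) (τ : LTree L) (h : γ * τ.degree ≤ 1) : qTree γ τ = 1 := by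
  rw [qTree, if_pos h]

theorem qTree_of_lt (γ : ℝ) (τ : LTree L) (h : 1 < γ * τ.degree) :
    qTree γ τ = ((2 : ℝ) ^ (γ * τ.degree) - 2)⁻¹ *
      Algebra.TensorProduct.productMap (MvPolynomial.aeval (qTree γ))
        (MvPolynomial.aeval (qTree γ)) (reducedCoproduct (ofTree τ)) := by
  rw [qTree, if_neg h.not_ge]
  congr 1
  have hm := reducedCoproduct_ofForest_mem {τ} (by simp)
  rw [show ofForest ({τ} : Multiset (LTree L)) = ofTree τ by simp [ofForest],
    show forestDegree ({τ} : Multiset (LTree L)) = τ.degree by simp [forestDegree]] at hm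
  have hpos : ∀ G : Multiset (LTree L), G ≠ 0 → 0 < forestDegree G := by
    intro G hG
    obtain ⟨σ, hσ⟩ := Multiset.exists_mem_of_ne_zero hG
    have : σ.degree ≤ forestDegree G :=
      Multiset.single_le_sum (fun _ _ => Nat.zero_le _) _ (Multiset.mem_map_of_mem _ hσ)
    have := σ.degree_eq
    omega
  have haux : ∀ G : Multiset (LTree L), forestDegree G < τ.degree →
      MvPolynomial.aeval (fun σ : LTree L => if _h : σ.degree < τ.degree then qTree γ σ else 0)
        (ofForest G) = MvPolynomial.aeval (qTree γ) (ofForest G) := by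
    intro G hG
    simp only [ofForest, map_multiset_prod, Multiset.map_map, Function.comp_def,
      MvPolynomial.aeval_X]
    refine congrArg _ (Multiset.map_congr rfl fun σ hσ => ?_)
    have : σ.degree ≤ forestDegree G :=
      Multiset.single_le_sum (fun _ _ => Nat.zero_le _) _ (Multiset.mem_map_of_mem _ hσ)
    rw [dif_pos (by omega)]
  refine LinearMap.eqOn_span
    (f := (Algebra.TensorProduct.productMap _ _).toLinearMap)
    (g := (Algebra.TensorProduct.productMap _ _).toLinearMap) ?_ hm
  rintro _ ⟨G, H, hG, hH, hGH, rfl⟩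
  have := hpos G hG
  have := hpos H hH
  simp only [AlgHom.toLinearMap_apply, Algebra.TensorProduct.productMap_apply_tmul]
  rw [haux G (by omega), haux H (by omega)]

/-! ### Increments -/

/-- The time interval `[0,T]`. -/
abbrev Time (T : ℝ) : Type := Set.Icc (0 : ℝ) T

variable {T : ℝ}

/-- `g ∈ 𝒞₂`: the value of `g` at `(t, s)` is written `g t s`. -/
def IsIncrement₂ (g : Time T → Time T → ℝ) : Prop := ∀ t, g t t = 0

/-- `h ∈ 𝒞₃`: the value of `h` at `(t, u, s)` is written `h t u s`. -/
def IsIncrement₃ (h : Time T → Time T → Time T → ℝ) : Prop :=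
  (∀ t s, h t t s = 0) ∧ ∀ t s, h t s s = 0

/-- The coboundary `(δ g)_{tus} = g_{ts} - g_{tu} - g_{us}`. -/
def coboundary (g : Time T → Time T → ℝ) (t u s : Time T) : ℝ := g t s - g t u - g u s

/-- `‖g‖_μ = sup_{s,t} |g_{ts}| / |t - s|^μ`, in `[0, ∞]` (where `0 / 0 = 0`). -/
def norm₂ (μ : ℝ) (g : Time T → Time T → ℝ) : ℝ≥0∞ :=
  ⨆ (s : Time T) (t : Time T), ENNReal.ofReal |g t s| / ENNReal.ofReal (|(t : ℝ) - s| ^ μ)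

/-- `‖h‖_{ρ,ρ'} = sup_{s,u,t} |h_{tus}| / (|u - s|^ρ |t - u|^ρ')`, in `[0, ∞]`. -/
def biNorm₃ (ρ ρ' : ℝ) (h : Time T → Time T → Time T → ℝ) : ℝ≥0∞ :=
  ⨆ (s : Time T) (u : Time T) (t : Time T),
    ENNReal.ofReal |h t u s| / ENNReal.ofReal (|(u : ℝ) - s| ^ ρ * |(t : ℝ) - u| ^ ρ')

/-- `‖h‖_μ = inf ∑ᵢ ‖hᵢ‖_{ρᵢ, μ - ρᵢ}` over all sequences `hᵢ ∈ 𝒞₃` and `ρᵢ ∈ (0, μ)` with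
`h = ∑ᵢ hᵢ`. Finite sums are included, as `hᵢ = 0` is allowed. -/
def norm₃ (μ : ℝ) (h : Time T → Time T → Time T → ℝ) : ℝ≥0∞ :=
  ⨅ (g : ℕ → Time T → Time T → Time T → ℝ) (ρ : ℕ → ℝ)
    (_ : (∀ i, IsIncrement₃ (g i)) ∧ (∀ i, 0 < ρ i ∧ ρ i < μ) ∧
      ∀ t u s, HasSum (fun i => g i t u s) (h t u s)),
    ∑' i, biNorm₃ (ρ i) (μ - ρ i) (g i)

/-- `g ∈ 𝒞₂^μ`. -/
def MemC₂ (μ : ℝ) (g : Time T → Time T → ℝ) : Prop := IsIncrement₂ g ∧ norm₂ μ g < ∞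

/-- `h ∈ 𝒞₃^μ`. -/
def MemC₃ (μ : ℝ) (h : Time T → Time T → Time T → ℝ) : Prop := IsIncrement₃ h ∧ norm₃ μ h < ∞

/-- `g ∈ 𝒞₂^{1+} = ⋃_{μ > 1} 𝒞₂^μ`. -/
def MemC₂OnePlus (g : Time T → Time T → ℝ) : Prop := ∃ μ > 1, MemC₂ μ g

/-- `h ∈ 𝒞₃^{1+} = ⋃_{μ > 1} 𝒞₃^μ`. -/
def MemC₃OnePlus (h : Time T → Time T → Time T → ℝ) : Prop := ∃ μ > 1, MemC₃ μ h

/-- The extension of `X` to `𝒜𝒯 ⊗ 𝒜𝒯` by the exterior product: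
`X^{σ ⊗ ρ}_{tus} = X^σ_{tu} X^ρ_{us}`. -/
def tensorExt (X : TreeAlg L →ₗ[ℝ] (Time T → Time T → ℝ)) :
    TreeAlg L ⊗[ℝ] TreeAlg L →ₗ[ℝ] (Time T → Time T → Time T → ℝ) :=
  TensorProduct.lift <| LinearMap.mk₂ ℝ (fun σ ρ t u s => X σ t u * X ρ u s)
    (by intros; ext; simp [add_mul]) (by intros; ext; simp [mul_assoc])
    (by intros; ext; simp [mul_add]) (by intros; ext; simp [mul_left_comm])

/-! ### Branched rough paths -/

/-- `X` is a branched rough path of roughness `γ` on `[0,T]`: a homomorphism from the tree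
algebra to the unital algebra `𝒞₂ ⊕ ℝ e` (pointwise products, `e = 1`) which maps trees to
`𝒞₂`, such that `δ X^σ = X^{Δ' σ}` and `‖X^F‖_{γ|F|} ≤ B A^{|F|} q_γ(F)` on forests. -/
structure IsBranchedRoughPath (γ : ℝ) (X : TreeAlg L →ₐ[ℝ] (Time T → Time T → ℝ)) : Prop where
  increment : ∀ τ : LTree L, IsIncrement₂ (X (ofTree τ))
  multiplicative : ∀ σ : TreeAlg L,
    coboundary (X σ) = tensorExt X.toLinearMap (reducedCoproduct σ)
  bound : ∃ A B : ℝ, 0 ≤ A ∧ 0 ≤ B ∧ B ≤ 1 ∧ ∀ F : Multiset (LTree L),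
    norm₂ (γ * forestDegree F) (X (ofForest F)) ≤
      ENNReal.ofReal (B * A ^ forestDegree F * qForest γ F)

/-- `X` restricts to a partial homomorphism `𝒜ₙ𝒯 → 𝒞₂ ⊕ ℝ e` mapping trees to `𝒞₂`, where `𝒜ₙ𝒯`
is the span of the forests of degree at most `n`. The values of `X` on forests of larger degree
play no role (every linear map on `𝒜ₙ𝒯` extends to a linear map on the whole algebra). -/
structure IsPartialHom (n : ℕ) (X : TreeAlg L →ₗ[ℝ] (Time T → Time T → ℝ)) : Prop where
  map_one : X 1 = 1
  map_mul : ∀ F G : Multiset (LTree L), forestDegree (F + G) ≤ n →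
    X (ofForest (F + G)) = X (ofForest F) * X (ofForest G)
  increment : ∀ τ : LTree L, τ.degree ≤ n → IsIncrement₂ (X (ofTree τ))

/-- The defect `R^τ = δ X^τ - X^{Δ' τ}` of the multiplicative relation at a tree `τ`. For
`|τ| ≤ n` it only involves the values of `X` on `𝒜ₙ𝒯`. -/
def remainder (X : TreeAlg L →ₗ[ℝ] (Time T → Time T → ℝ)) (τ : LTree L) :
    Time T → Time T → Time T → ℝ :=
  coboundary (X (ofTree τ)) - tensorExt X (reducedCoproduct (ofTree τ))

/-- `X` is an almost branched rough path (of order `n` and roughness `γ`): a partial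
homomorphism on `𝒜ₙ𝒯` whose defects on trees are in `𝒞₃^{1+}`, with
`max_{|τ| ≤ n} ‖X^τ‖_{γ|τ|} ≤ K` for some constant `K`, and `γ > 1/(n+1)`. -/
structure IsAlmostBranchedRoughPath (n : ℕ) (γ : ℝ)
    (X : TreeAlg L →ₗ[ℝ] (Time T → Time T → ℝ)) : Prop where
  roughness : 1 / ((n : ℝ) + 1) < γ
  partialHom : IsPartialHom n X
  almost_multiplicative : ∀ τ : LTree L, τ.degree ≤ n → MemC₃OnePlus (remainder X τ)
  bound : ∃ K : ℝ, ∀ τ : LTree L, τ.degree ≤ n →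
    norm₂ (γ * τ.degree) (X (ofTree τ)) ≤ ENNReal.ofReal K

end BRP

end

/-!
Extend the given functional multiplicatively by zero to the trees with more than `n` vertices.
It is then almost multiplicative on all trees, to an order `μ > 1`: above degree `n` the defect
at `τ` is a sum of products of total order `γ|τ| ≥ (n + 1) γ > 1`. The branched rough path is
built tree by tree along the degree (`multLift`). If Chen's relation holds below `τ`, then
`X^{Δ' τ}` is closed, by coassociativity of the coproduct (`coproduct_coassoc`,
`chenTerm_cocycle`), hence it is the coboundary of some `f`. Since `X` and the given functional
are close below `τ`, `f` minus the given value at `τ` has a coboundary of order `μ`, and the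
sewing lemma (`exists_sewing`) provides the additive function by which `f` has to be corrected
(`exists_isLift`).

The sewing lemma has two parts. Sums over the dyadic partitions of `[0, T]`, intersected with
`[s, t]`, converge to an additive function which is close of an order between `1` and `μ`
(`exists_additive_near`). The a priori estimate `abs_le_of_coboundary_midTime`, obtained by
repeated halving, restores the order `μ` with the sharp constant `1 / (2^μ - 2)`.

This constant is the factor in the recursion for `q_γ`. As `Δ' τ` is a sum of terms `σ ⊗ H`
without signs (`reducedCoproduct_ofTree_eq_sum`), the same a priori estimate yields the bound
`A^{|τ|} q_γ(τ)` by induction on the degree (`abs_le_pow_mul_qTree`). Applied to a difference of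
two branched rough paths, which is additive once they agree on smaller trees, it yields
uniqueness (`IsBranchedRoughPath.eq_of_close`).
-/

noncomputable section

namespace BRP

variable {L : Type*} {T : ℝ}

/-! ### Forests, gradings and finiteness -/

theorem ofForest_zero : ofForest (0 : Multiset (LTree L)) = 1 := by simp [ofForest]

theorem ofForest_add (F G : Multiset (LTree L)) :
    ofForest (F + G) = ofForest F * ofForest G := by simp [ofForest]

theorem ofForest_cons (τ : LTree L) (F : Multiset (LTree L)) :
    ofForest (τ ::ₘ F) = ofTree τ * ofForest F := by simp [ofForest]

theorem ofForest_singleton (τ : LTree L) : ofForest {τ} = ofTree τ := by simp [ofForest]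

theorem forestDegree_zero : forestDegree (0 : Multiset (LTree L)) = 0 := rfl

theorem forestDegree_add (F G : Multiset (LTree L)) :
    forestDegree (F + G) = forestDegree F + forestDegree G := by simp [forestDegree]

theorem forestDegree_cons (τ : LTree L) (F : Multiset (LTree L)) :
    forestDegree (τ ::ₘ F) = τ.degree + forestDegree F := by simp [forestDegree]

theorem forestDegree_singleton (τ : LTree L) : forestDegree {τ} = τ.degree := by
  simp [forestDegree]

theorem LTree.degree_pos (τ : LTree L) : 0 < τ.degree := by rw [τ.degree_eq]; omega

theorem degree_le_forestDegree {τ : LTree L} {F : Multiset (LTree L)} (h : τ ∈ F) :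
    τ.degree ≤ forestDegree F :=
  Multiset.single_le_sum (fun _ _ => Nat.zero_le _) _ (Multiset.mem_map_of_mem _ h)

theorem forestDegree_pos {F : Multiset (LTree L)} (hF : F ≠ 0) : 0 < forestDegree F := by
  obtain ⟨σ, hσ⟩ := Multiset.exists_mem_of_ne_zero hF
  exact σ.degree_pos.trans_le (degree_le_forestDegree hσ)

theorem PlanarForest.finite_size_le [Finite L] (n : ℕ) :
    {f : PlanarForest L | f.size ≤ n}.Finite := by
  induction n with
  | zero =>
    refine (Set.finite_singleton PlanarForest.nil).subset ?_
    rintro (_ | ⟨a, f, g⟩) h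
    · rfl
    · simp [PlanarForest.size] at h
  | succ n ih =>
    refine ((Set.finite_singleton PlanarForest.nil).union
      (((Set.finite_univ (α := L)).prod (ih.prod ih)).image
        fun p => PlanarForest.cons p.1 p.2.1 p.2.2)).subset ?_
    rintro (_ | ⟨a, f, g⟩) h
    · exact Or.inl rfl
    · simp only [PlanarForest.size, Set.mem_ofPred_eq] at h
      refine Or.inr ⟨(a, f, g), ⟨trivial, ?_, ?_⟩, rfl⟩ <;> simp only [Set.mem_ofPred_eq] <;> omega

theorem LTree.finite_degree_le [Finite L] (n : ℕ) : {τ : LTree L | τ.degree ≤ n}.Finite := by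
  refine (((Set.finite_univ (α := L)).prod (PlanarForest.finite_size_le n)).image
    fun p => (⟨p.1, Quotient.mk _ p.2⟩ : LTree L)).subset ?_
  rintro ⟨a, ⟨f⟩⟩ h
  change 1 + f.size ≤ n at h
  exact ⟨(a, f), ⟨trivial, by simp only [Set.mem_ofPred_eq]; omega⟩, rfl⟩

/-! ### Coassociativity and the convolution of characters -/

theorem basisMonomials_eq_ofForest (m : LTree L →₀ ℕ) :
    MvPolynomial.basisMonomials (LTree L) ℝ m = ofForest (Finsupp.toMultiset m) := by
  rw [MvPolynomial.coe_basisMonomials]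
  change MvPolynomial.monomial m (1 : ℝ) = _
  rw [MvPolynomial.monomial_eq, Finsupp.prod, ofForest,
    Finsupp.toMultiset_map, Finsupp.prod_toMultiset,
    Finsupp.prod_mapDomain_index (by simp) (by simp [pow_add])]
  simp [Finsupp.prod]

/-- Forests span the tree algebra. -/
theorem linearMap_ext_ofForest {M : Type*} [AddCommGroup M] [Module ℝ M]
    {f g : TreeAlg L →ₗ[ℝ] M} (h : ∀ F, f (ofForest F) = g (ofForest F)) : f = g :=
  (MvPolynomial.basisMonomials (LTree L) ℝ).ext fun m => by
    rw [basisMonomials_eq_ofForest]; exact h _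

theorem coproduct_Bplus (a : L) (x : TreeAlg L) :
    coproduct (Bplus a x) = 1 ⊗ₜ Bplus a x +
      TensorProduct.map (Bplus a) LinearMap.id (coproduct x) := by
  have : coproduct.toLinearMap ∘ₗ Bplus a =
      (TensorProduct.mk ℝ (TreeAlg L) (TreeAlg L) 1) ∘ₗ Bplus a +
      (TensorProduct.map (Bplus a) LinearMap.id) ∘ₗ coproduct.toLinearMap := by
    refine linearMap_ext_ofForest fun F => ?_
    simpa [Bplus_ofForest] using coproduct_node a F
  exact LinearMap.congr_fun this x

/-- Coassociativity of the coproduct. Both sides are algebra homomorphisms, so it suffices to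
treat trees `B₊^a F`, where the cocycle relation `coproduct_Bplus` reduces the claim to `F`. -/
theorem coproduct_coassoc :
    (Algebra.TensorProduct.map (AlgHom.id ℝ (TreeAlg L)) coproduct).comp coproduct =
      ((Algebra.TensorProduct.assoc ℝ ℝ ℝ (TreeAlg L) (TreeAlg L) (TreeAlg L)).toAlgHom.comp
        (Algebra.TensorProduct.map coproduct (AlgHom.id ℝ (TreeAlg L)))).comp coproduct := by
  set c₁ := (Algebra.TensorProduct.map (AlgHom.id ℝ (TreeAlg L)) coproduct).comp coproduct
    with hc₁
  set c₂ := ((Algebra.TensorProduct.assoc ℝ ℝ ℝ (TreeAlg L) (TreeAlg L) (TreeAlg L)).toAlgHom.comp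
        (Algebra.TensorProduct.map coproduct (AlgHom.id ℝ (TreeAlg L)))).comp coproduct with hc₂
  refine MvPolynomial.algHom_ext fun τ => ?_
  induction hd : τ.degree using Nat.strong_induction_on generalizing τ with
  | _ d ih =>
  subst hd
  obtain ⟨a, F, rfl⟩ : ∃ a F, τ = LTree.node a F := ⟨_, _, τ.node_branches.symm⟩
  have hF : c₁ (ofForest F) = c₂ (ofForest F) := by
    simp only [ofForest, map_multiset_prod, Multiset.map_map]
    refine congrArg _ (Multiset.map_congr rfl fun σ hσ => ?_)
    exact ih _ (LTree.degree_lt_of_mem (by simpa using hσ)) σ rfl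
  have h₁ : ∀ z : TreeAlg L ⊗[ℝ] TreeAlg L,
      Algebra.TensorProduct.map (AlgHom.id ℝ (TreeAlg L)) coproduct
        (TensorProduct.map (Bplus a) LinearMap.id z) =
      TensorProduct.map (Bplus a) LinearMap.id
        (Algebra.TensorProduct.map (AlgHom.id ℝ (TreeAlg L)) coproduct z) := by
    intro z
    induction z with
    | zero => simp
    | add x y hx hy => simp only [map_add, hx, hy]
    | tmul x y => simp
  have h₂ : ∀ z : TreeAlg L ⊗[ℝ] TreeAlg L,
      Algebra.TensorProduct.assoc ℝ ℝ ℝ (TreeAlg L) (TreeAlg L) (TreeAlg L)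
        (Algebra.TensorProduct.map coproduct (AlgHom.id ℝ (TreeAlg L))
        (TensorProduct.map (Bplus a) LinearMap.id z)) =
      1 ⊗ₜ (TensorProduct.map (Bplus a) LinearMap.id z) +
      TensorProduct.map (Bplus a) LinearMap.id
        (Algebra.TensorProduct.assoc ℝ ℝ ℝ (TreeAlg L) (TreeAlg L) (TreeAlg L)
        (Algebra.TensorProduct.map coproduct (AlgHom.id ℝ (TreeAlg L)) z)) := by
    intro z
    induction z with
    | zero => simp
    | add x y hx hy => simp only [map_add, hx, hy, TensorProduct.tmul_add]; abel
    | tmul x y =>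
      simp only [TensorProduct.map_tmul, Algebra.TensorProduct.map_tmul, coproduct_Bplus,
        LinearMap.id_apply, AlgHom.id_apply, TensorProduct.add_tmul, map_add,
        Algebra.TensorProduct.assoc_tmul]
      congr 1
      generalize coproduct x = w
      induction w with
      | zero => simp
      | add x y hx hy => simp only [map_add, hx, hy, TensorProduct.add_tmul]
      | tmul x y => simp
  have e₁ : c₁ (ofTree (LTree.node a F)) =
      1 ⊗ₜ coproduct (ofTree (LTree.node a F)) +
        TensorProduct.map (Bplus a) LinearMap.id (c₁ (ofForest F)) := by
    rw [hc₁, AlgHom.comp_apply, coproduct_node, map_add, h₁, ← coproduct_node]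
    simp
  have e₂ : c₂ (ofTree (LTree.node a F)) =
      1 ⊗ₜ coproduct (ofTree (LTree.node a F)) +
        TensorProduct.map (Bplus a) LinearMap.id (c₂ (ofForest F)) := by
    change Algebra.TensorProduct.assoc ℝ ℝ ℝ (TreeAlg L) (TreeAlg L) (TreeAlg L)
        (Algebra.TensorProduct.map coproduct (AlgHom.id ℝ (TreeAlg L)) (coproduct _)) = _
    rw [coproduct_node, map_add, map_add, h₂, TensorProduct.tmul_add, add_assoc]
    congr 1
    simp [Algebra.TensorProduct.one_def]
  change c₁ (ofTree (LTree.node a F)) = c₂ (ofTree (LTree.node a F))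
  rw [e₁, e₂, hF]

/-- The convolution product of two characters of the tree algebra. -/
def conv (φ ψ : TreeAlg L →ₐ[ℝ] ℝ) : TreeAlg L →ₐ[ℝ] ℝ :=
  (Algebra.TensorProduct.productMap φ ψ).comp coproduct

theorem conv_assoc (φ ψ χ : TreeAlg L →ₐ[ℝ] ℝ) :
    conv (conv φ ψ) χ = conv φ (conv ψ χ) := by
  have h₁ : ∀ z : TreeAlg L ⊗[ℝ] TreeAlg L,
      Algebra.TensorProduct.productMap (conv φ ψ) χ z =
      Algebra.TensorProduct.productMap φ (Algebra.TensorProduct.productMap ψ χ)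
        (Algebra.TensorProduct.assoc ℝ ℝ ℝ (TreeAlg L) (TreeAlg L) (TreeAlg L)
        (Algebra.TensorProduct.map coproduct (AlgHom.id ℝ (TreeAlg L)) z)) := by
    intro z
    induction z with
    | zero => simp
    | add x y hx hy => simp only [map_add, hx, hy]
    | tmul x y =>
      simp only [Algebra.TensorProduct.map_tmul, Algebra.TensorProduct.productMap_apply_tmul,
        conv, AlgHom.comp_apply, AlgHom.id_apply]
      generalize coproduct x = w
      induction w with
      | zero => simp
      | add x y hx hy => simp only [map_add, add_mul, hx, hy, TensorProduct.add_tmul]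
      | tmul x y => simp [mul_assoc]
  have h₂ : ∀ z : TreeAlg L ⊗[ℝ] TreeAlg L,
      Algebra.TensorProduct.productMap φ (conv ψ χ) z =
      Algebra.TensorProduct.productMap φ (Algebra.TensorProduct.productMap ψ χ)
        (Algebra.TensorProduct.map (AlgHom.id ℝ (TreeAlg L)) coproduct z) := by
    intro z
    induction z with
    | zero => simp
    | add x y hx hy => simp only [map_add, hx, hy]
    | tmul x y => simp [conv]
  refine AlgHom.ext fun x => ?_
  refine (h₁ _).trans (Eq.trans ?_ (h₂ _).symm)
  exact congrArg _ (AlgHom.congr_fun coproduct_coassoc x).symm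

theorem conv_apply_eq_reducedCoproduct (φ ψ : TreeAlg L →ₐ[ℝ] ℝ) (x : TreeAlg L) :
    conv φ ψ x =
      φ x + ψ x + Algebra.TensorProduct.productMap φ ψ (reducedCoproduct x) := by
  rw [reducedCoproduct_apply]
  simp only [conv, AlgHom.comp_apply, map_sub, Algebra.TensorProduct.productMap_apply_tmul,
    map_one, one_mul, mul_one]
  ring

/-! ### Positivity of the reduced coproduct -/

theorem multiset_sum_mul_sum {α β R : Type*} [Semiring R] (s : Multiset α) (t : Multiset β)
    (f : α → R) (g : β → R) :
    (s.map f).sum * (t.map g).sum = ((s ×ˢ t).map fun p => f p.1 * g p.2).sum := by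
  induction s using Multiset.induction_on with
  | empty => simp
  | cons a s ih =>
    simp [Multiset.cons_product, add_mul, ih, Multiset.map_map, Multiset.sum_map_mul_left]

/-- A forest `F` satisfies `Δ F = F ⊗ 1 + ∑ G ⊗ H`, a finite sum with nonempty forests `H` and
`|G| + |H| = |F|`. In contrast to a statement about linear spans, no signs occur. -/
theorem coproduct_ofForest_eq_sum (F : Multiset (LTree L)) :
    ∃ M : Multiset (Multiset (LTree L) × Multiset (LTree L)),
      (∀ p ∈ M, p.2 ≠ 0 ∧ forestDegree p.1 + forestDegree p.2 = forestDegree F) ∧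
      coproduct (ofForest F) =
        ofForest F ⊗ₜ 1 + (M.map fun p => ofForest p.1 ⊗ₜ[ℝ] ofForest p.2).sum := by
  induction hd : forestDegree F using Nat.strong_induction_on generalizing F with
  | _ d ih =>
  subst hd
  induction F using Multiset.induction_on with
  | empty => exact ⟨0, by simp, by simp [ofForest_zero, Algebra.TensorProduct.one_def]⟩
  | cons τ F ihF =>
    have hτ := τ.degree_pos
    rw [forestDegree_cons] at ih
    obtain ⟨M, hM, eM⟩ := ihF fun m hm G hG => ih m (by omega) G hG
    obtain ⟨N, hN, eN⟩ : ∃ N : Multiset (Multiset (LTree L) × Multiset (LTree L)),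
        (∀ p ∈ N, p.2 ≠ 0 ∧ forestDegree p.1 + forestDegree p.2 = τ.degree) ∧
        coproduct (ofTree τ) =
          ofTree τ ⊗ₜ 1 + (N.map fun p => ofForest p.1 ⊗ₜ[ℝ] ofForest p.2).sum := by
      obtain ⟨a, B, rfl⟩ : ∃ a B, τ = LTree.node a B := ⟨_, _, τ.node_branches.symm⟩
      rw [LTree.degree_node] at *
      obtain ⟨N, hN, eN⟩ := ih (forestDegree B) (by omega) B rfl
      refine ⟨(0, {LTree.node a B}) ::ₘ N.map fun p => ({LTree.node a p.1}, p.2), ?_, ?_⟩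
      · intro p hp
        rw [Multiset.mem_cons, Multiset.mem_map] at hp
        rcases hp with rfl | ⟨p, hp, rfl⟩
        · simp [forestDegree_zero, forestDegree_singleton, LTree.degree_node]
        · have := hN p hp
          simp only [forestDegree_singleton, LTree.degree_node]
          exact ⟨this.1, by omega⟩
      · rw [coproduct_node, eN, map_add, map_multiset_sum, Multiset.map_cons, Multiset.sum_cons,
          Multiset.map_map, Multiset.map_map]
        simp only [Function.comp_def, TensorProduct.map_tmul, Bplus_ofForest, ofForest_singleton,
          ofForest_zero, LinearMap.id_apply]
        abel
    refine ⟨(N ×ˢ M).map (fun p => (p.1.1 + p.2.1, p.1.2 + p.2.2)) +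
      (N.map (fun p => (p.1 + F, p.2)) + M.map (fun p => (τ ::ₘ p.1, p.2))), ?_, ?_⟩
    · intro p hp
      rw [forestDegree_cons]
      simp only [Multiset.mem_add, Multiset.mem_map, Multiset.mem_product] at hp
      rcases hp with ⟨⟨p, q⟩, ⟨hp, hq⟩, rfl⟩ | ⟨p, hp, rfl⟩ | ⟨p, hp, rfl⟩
      · have h₁ := hN p hp
        have h₂ := hM q hq
        simp only [forestDegree_add]
        refine ⟨by simp [h₁.1], by omega⟩
      · have h₁ := hN p hp
        simp only [forestDegree_add]
        exact ⟨h₁.1, by omega⟩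
      · have h₁ := hM p hp
        simp only [forestDegree_cons]
        exact ⟨h₁.1, by omega⟩
    · have hprod : (N.map fun p => ofForest p.1 ⊗ₜ[ℝ] ofForest p.2).sum *
          (M.map fun p => ofForest p.1 ⊗ₜ[ℝ] ofForest p.2).sum =
          (((N ×ˢ M).map (fun p => (p.1.1 + p.2.1, p.1.2 + p.2.2))).map
            fun p => ofForest p.1 ⊗ₜ[ℝ] ofForest p.2).sum := by
        rw [multiset_sum_mul_sum, Multiset.map_map]
        simp [ofForest_add]
      have h1 : (N.map fun p => ofForest p.1 ⊗ₜ[ℝ] ofForest p.2).sum * ofForest F ⊗ₜ 1 =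
          ((N.map (fun p => (p.1 + F, p.2))).map
            fun p => ofForest p.1 ⊗ₜ[ℝ] ofForest p.2).sum := by
        rw [← Multiset.sum_map_mul_right, Multiset.map_map]
        simp [ofForest_add]
      have h2 : ofTree τ ⊗ₜ 1 * (M.map fun p => ofForest p.1 ⊗ₜ[ℝ] ofForest p.2).sum =
          ((M.map (fun p => (τ ::ₘ p.1, p.2))).map
            fun p => ofForest p.1 ⊗ₜ[ℝ] ofForest p.2).sum := by
        rw [← Multiset.sum_map_mul_left, Multiset.map_map]
        simp [ofForest_cons]
      have h3 : ofForest (τ ::ₘ F) ⊗ₜ[ℝ] (1 : TreeAlg L) = ofTree τ ⊗ₜ 1 * ofForest F ⊗ₜ 1 := by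
        simp [ofForest_cons]
      rw [Multiset.map_add, Multiset.map_add, Multiset.sum_add, Multiset.sum_add, ← hprod, ← h1,
        ← h2, h3, ofForest_cons, map_mul, eM, eN]
      ring

/-- `Δ' τ` is a finite sum of terms `σ ⊗ H`, without signs, with trees `σ`, nonempty forests
`H` and `|σ| + |H| = |τ|`. -/
theorem reducedCoproduct_ofTree_eq_sum (τ : LTree L) :
    ∃ M : Multiset (LTree L × Multiset (LTree L)),
      (∀ p ∈ M, p.2 ≠ 0 ∧ p.1.degree + forestDegree p.2 = τ.degree) ∧
      reducedCoproduct (ofTree τ) = (M.map fun p => ofTree p.1 ⊗ₜ[ℝ] ofForest p.2).sum := by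
  obtain ⟨a, B, rfl⟩ : ∃ a B, τ = LTree.node a B := ⟨_, _, τ.node_branches.symm⟩
  obtain ⟨M, hM, eM⟩ := coproduct_ofForest_eq_sum B
  refine ⟨M.map fun p => (LTree.node a p.1, p.2), ?_, ?_⟩
  · intro p hp
    obtain ⟨q, hq, rfl⟩ := Multiset.mem_map.1 hp
    have := hM q hq
    simp only [LTree.degree_node]
    exact ⟨this.1, by omega⟩
  · rw [reducedCoproduct_apply, coproduct_node, eM, map_add, map_multiset_sum, Multiset.map_map,
      Multiset.map_map]
    simp only [Function.comp_def, TensorProduct.map_tmul, Bplus_ofForest, LinearMap.id_apply]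
    abel

/-! ### Norms as pointwise bounds -/

theorem abs_le_of_ofReal_div_le {x y : ℝ} {c : ℝ≥0∞} (hc : c ≠ ⊤) (hy : 0 ≤ y)
    (h : ENNReal.ofReal |x| / ENNReal.ofReal y ≤ c) : |x| ≤ c.toReal * y := by
  have h' : ENNReal.ofReal |x| ≤ c * ENNReal.ofReal y := by
    refine (ENNReal.div_le_iff_le_mul ?_ (Or.inl ENNReal.ofReal_ne_top)).1 h
    exact Or.inr hc
  have := ENNReal.toReal_mono (ENNReal.mul_ne_top hc ENNReal.ofReal_ne_top) h'
  rwa [ENNReal.toReal_mul, ENNReal.toReal_ofReal (abs_nonneg _), ENNReal.toReal_ofReal hy] at this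

/-- The bound includes the diagonal: for `μ > 0` both sides force `g t t = 0`, as `x / 0 = ∞` for
`x ≠ 0` in `[0, ∞]`. -/
theorem norm₂_le_iff {μ C : ℝ} (hC : 0 ≤ C) {g : Time T → Time T → ℝ} :
    norm₂ μ g ≤ ENNReal.ofReal C ↔ ∀ t s : Time T, |g t s| ≤ C * |(t : ℝ) - s| ^ μ := by
  simp only [norm₂, iSup_le_iff]
  constructor
  · intro h t s
    have := abs_le_of_ofReal_div_le ENNReal.ofReal_ne_top
      (Real.rpow_nonneg (abs_nonneg _) _) (h s t)
    rwa [ENNReal.toReal_ofReal hC] at this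
  · intro h s t
    refine ENNReal.div_le_of_le_mul ?_
    rw [← ENNReal.ofReal_mul hC]
    exact ENNReal.ofReal_le_ofReal (h t s)

theorem norm₂_lt_top_iff {μ : ℝ} {g : Time T → Time T → ℝ} :
    norm₂ μ g < ⊤ ↔ ∃ C : ℝ, 0 ≤ C ∧ ∀ t s : Time T, |g t s| ≤ C * |(t : ℝ) - s| ^ μ := by
  constructor
  · intro h
    refine ⟨(norm₂ μ g).toReal, ENNReal.toReal_nonneg,
      (norm₂_le_iff ENNReal.toReal_nonneg).1 (ENNReal.ofReal_toReal h.ne).ge⟩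
  · rintro ⟨C, hC, h⟩
    exact ((norm₂_le_iff hC).2 h).trans_lt ENNReal.ofReal_lt_top

/-- The bound on `h` extracted from `‖h‖_μ < ∞`: each `|u - s|^ρ |t - u|^(μ - ρ)` is at most
`max(|t - u|, |u - s|)^μ`, whatever `ρ`. -/
theorem exists_bound_of_norm₃_lt_top {μ : ℝ} {h : Time T → Time T → Time T → ℝ}
    (hh : norm₃ μ h < ⊤) : ∃ C : ℝ, 0 ≤ C ∧ ∀ t u s : Time T,
      |h t u s| ≤ C * max |(t : ℝ) - u| |(u : ℝ) - s| ^ μ := by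
  simp only [norm₃, iInf_lt_iff] at hh
  obtain ⟨g, ρ, ⟨-, hρ, hsum⟩, hlt⟩ := hh
  refine ⟨(∑' i, biNorm₃ (ρ i) (μ - ρ i) (g i)).toReal, ENNReal.toReal_nonneg, fun t u s => ?_⟩
  have hne : ∀ i, biNorm₃ (ρ i) (μ - ρ i) (g i) ≠ ⊤ := ENNReal.ne_top_of_tsum_ne_top hlt.ne
  set m := max |(t : ℝ) - u| |(u : ℝ) - s|
  have hm : 0 ≤ m := (abs_nonneg _).trans (le_max_left _ _)
  have hi : ∀ i, |g i t u s| ≤ (biNorm₃ (ρ i) (μ - ρ i) (g i)).toReal * m ^ μ := by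
    intro i
    have h1 : ENNReal.ofReal |g i t u s| /
        ENNReal.ofReal (|(u : ℝ) - s| ^ ρ i * |(t : ℝ) - u| ^ (μ - ρ i)) ≤
        biNorm₃ (ρ i) (μ - ρ i) (g i) :=
      le_iSup_of_le s (le_iSup_of_le u (le_iSup_of_le t le_rfl))
    refine (abs_le_of_ofReal_div_le (hne i) (by positivity) h1).trans ?_
    refine mul_le_mul_of_nonneg_left ?_ ENNReal.toReal_nonneg
    have h2 : m ^ μ = m ^ ρ i * m ^ (μ - ρ i) := by
      rw [← Real.rpow_add_of_nonneg hm (hρ i).1.le (by linarith [(hρ i).2])]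
      congr 1; ring
    rw [h2]
    gcongr
    · exact (hρ i).1.le
    · exact le_max_right _ _
    · linarith [(hρ i).2]
    · exact le_max_left _ _
  have hS : Summable fun i => (biNorm₃ (ρ i) (μ - ρ i) (g i)).toReal * m ^ μ :=
    (ENNReal.summable_toReal hlt.ne).mul_right _
  rw [← (hsum t u s).tsum_eq, ENNReal.tsum_toReal_eq hne, ← tsum_mul_right]
  have := tsum_of_norm_bounded hS.hasSum (fun i => by rw [Real.norm_eq_abs]; exact hi i)
  rwa [Real.norm_eq_abs] at this

theorem abs_sub_le_T (t s : Time T) : |(t : ℝ) - s| ≤ T := by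
  have := t.2.1; have := t.2.2; have := s.2.1; have := s.2.2
  rw [abs_le]; constructor <;> linarith

/-- On a bounded interval, Hölder exponents may be lowered. -/
theorem exists_rpow_le_mul_rpow (T : ℝ) {μ ν : ℝ} (h : ν ≤ μ) (hν : 0 < ν) :
    ∃ C : ℝ, 0 ≤ C ∧ ∀ x : ℝ, 0 ≤ x → x ≤ T → x ^ μ ≤ C * x ^ ν := by
  refine ⟨|T| ^ (μ - ν), by positivity, fun x hx hxT => ?_⟩
  have : x ^ μ = x ^ (μ - ν) * x ^ ν := by
    rw [← Real.rpow_add_of_nonneg hx (by linarith) hν.le]; congr 1; ring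
  rw [this]
  gcongr
  exact hxT.trans (le_abs_self _)

/-! ### The sewing lemma -/

/-- The midpoint of two times. -/
def midTime (t s : Time T) : Time T :=
  ⟨((t : ℝ) + s) / 2, by
    have := t.2.1; have := t.2.2; have := s.2.1; have := s.2.2
    constructor <;> linarith⟩

theorem abs_sub_midTime_left (t s : Time T) : |(t : ℝ) - midTime t s| = |(t : ℝ) - s| / 2 := by
  rw [midTime, show (t : ℝ) - ((t : ℝ) + s) / 2 = (t - s) / 2 by ring, abs_div, abs_two]

theorem abs_sub_midTime_right (t s : Time T) : |(midTime t s : ℝ) - s| = |(t : ℝ) - s| / 2 := by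
  rw [midTime, show ((t : ℝ) + s) / 2 - (s : ℝ) = (t - s) / 2 by ring, abs_div, abs_two]

/-- The a priori estimate of the sewing lemma, with the sharp constant `1 / (2^μ - 2)`: this is
the fixed point of the map `M' ↦ 2 * 2^(-μ) * M' + 2^(-μ) * M` that describes how the constant
changes when an interval is halved, while the constant in the rough bound of exponent `ν > 1`
is contracted by `2^(1 - ν)`. -/
theorem abs_le_of_coboundary_midTime {g : Time T → Time T → ℝ} {μ ν K M : ℝ} (hμ : 1 < μ)
    (hν : 1 < ν) (hg : ∀ t s : Time T, |g t s| ≤ K * |(t : ℝ) - s| ^ ν)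
    (hδ : ∀ t s : Time T,
      |coboundary g t (midTime t s) s| ≤ M * (|(t : ℝ) - s| / 2) ^ μ) (hM : 0 ≤ M)
    (t s : Time T) : |g t s| ≤ ((2 : ℝ) ^ μ - 2)⁻¹ * M * |(t : ℝ) - s| ^ μ := by
  have h2 : (2 : ℝ) < 2 ^ μ := by
    simpa using Real.rpow_lt_rpow_of_exponent_lt (one_lt_two) hμ
  set M' := ((2 : ℝ) ^ μ - 2)⁻¹ * M with hM'
  have hM'0 : 0 ≤ M' := mul_nonneg (inv_nonneg.2 (by linarith)) hM
  have hfix : M' * 2 ^ μ = 2 * M' + M := by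
    rw [hM']; field_simp [show (2 : ℝ) ^ μ - 2 ≠ 0 by linarith]; ring
  set r : ℝ := 2 / 2 ^ ν with hr
  have key : ∀ k : ℕ, ∀ t s : Time T,
      |g t s| ≤ K * r ^ k * |(t : ℝ) - s| ^ ν + M' * |(t : ℝ) - s| ^ μ := by
    intro k
    induction k with
    | zero =>
      intro t s
      have := hg t s
      have : 0 ≤ M' * |(t : ℝ) - s| ^ μ := by positivity
      simp only [pow_zero, mul_one]; linarith
    | succ k ih =>
      intro t s
      have h1 := ih t (midTime t s)
      have h3 := ih (midTime t s) s
      have h4 := hδ t s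
      rw [abs_sub_midTime_left] at h1
      rw [abs_sub_midTime_right] at h3
      have hd : ∀ α : ℝ, (|(t : ℝ) - s| / 2) ^ α = |(t : ℝ) - s| ^ α / 2 ^ α :=
        fun α => Real.div_rpow (abs_nonneg _) zero_le_two α
      rw [hd, hd] at h1 h3
      rw [hd] at h4
      have h5 : g t s =
          coboundary g t (midTime t s) s + (g t (midTime t s) + g (midTime t s) s) := by
        simp only [coboundary]; ring
      have h6 : |g t s| ≤ |coboundary g t (midTime t s) s| +
          (|g t (midTime t s)| + |g (midTime t s) s|) := by
        rw [h5]; exact (abs_add_le _ _).trans (add_le_add_right (abs_add_le _ _) _)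
      have h7 : K * r ^ (k + 1) * |(t : ℝ) - s| ^ ν =
          2 * (K * r ^ k * (|(t : ℝ) - s| ^ ν / 2 ^ ν)) := by
        rw [pow_succ, hr]; ring
      have h8 : M' * |(t : ℝ) - s| ^ μ =
          2 * (M' * (|(t : ℝ) - s| ^ μ / 2 ^ μ)) + M * (|(t : ℝ) - s| ^ μ / 2 ^ μ) := by
        have : (2 : ℝ) ^ μ ≠ 0 := by positivity
        field_simp
        linear_combination |(t : ℝ) - s| ^ μ * hfix
      rw [h7, h8]
      linarith
  have hr1 : r < 1 := by
    rw [hr, div_lt_one (by positivity)]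
    simpa using Real.rpow_lt_rpow_of_exponent_lt (one_lt_two) hν
  have hr0 : 0 ≤ r := by positivity
  have hlim : Filter.Tendsto (fun k : ℕ => K * r ^ k * |(t : ℝ) - s| ^ ν + M' * |(t : ℝ) - s| ^ μ)
      Filter.atTop (nhds (K * 0 * |(t : ℝ) - s| ^ ν + M' * |(t : ℝ) - s| ^ μ)) :=
    (((tendsto_pow_atTop_nhds_zero_of_lt_one hr0 hr1).const_mul K).mul_const _).add_const _
  have := ge_of_tendsto' hlim fun k => key k t s
  simpa using this

/-- The sum of `G` over the `2^m` intervals obtained by bisecting `[a, b]` repeatedly. -/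
def dyadicSum (G : ℝ → ℝ → ℝ) : ℕ → ℝ → ℝ → ℝ
  | 0, a, b => G a b
  | m + 1, a, b => dyadicSum G m a ((a + b) / 2) + dyadicSum G m ((a + b) / 2) b

theorem dyadicSum_sub (G H : ℝ → ℝ → ℝ) (m : ℕ) (a b : ℝ) :
    dyadicSum (fun x y => G x y - H x y) m a b = dyadicSum G m a b - dyadicSum H m a b := by
  induction m generalizing a b with
  | zero => rfl
  | succ m ih => simp only [dyadicSum, ih]; ring

theorem dyadicSum_succ' (G : ℝ → ℝ → ℝ) (m : ℕ) (a b : ℝ) :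
    dyadicSum G (m + 1) a b =
      dyadicSum (fun x y => G x ((x + y) / 2) + G ((x + y) / 2) y) m a b := by
  induction m generalizing a b with
  | zero => rfl
  | succ m ih => rw [dyadicSum, ih, ih]; rfl

/-- If `G` is small on short intervals relative to an additive functional, then so are its
dyadic sums. -/
theorem abs_dyadicSum_le {G : ℝ → ℝ → ℝ} {p : ℝ → ℝ} {K θ : ℝ}
    (hG : ∀ a b, a ≤ b → |G a b| ≤ K * (b - a) ^ θ * (p b - p a)) (m : ℕ) (a b : ℝ)
    (hab : a ≤ b) : |dyadicSum G m a b| ≤ K * ((b - a) / 2 ^ m) ^ θ * (p b - p a) := by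
  induction m generalizing a b with
  | zero => simpa [dyadicSum] using hG a b hab
  | succ m ih =>
    have h1 := ih a ((a + b) / 2) (by linarith)
    have h2 := ih ((a + b) / 2) b (by linarith)
    have e1 : ((a + b) / 2 - a) / 2 ^ m = (b - a) / 2 ^ (m + 1) := by rw [pow_succ]; field_simp; ring
    have e2 : (b - (a + b) / 2) / 2 ^ m = (b - a) / 2 ^ (m + 1) := by rw [pow_succ]; field_simp; ring
    rw [e1] at h1
    rw [e2] at h2
    rw [dyadicSum]
    refine (abs_add_le _ _).trans ((add_le_add h1 h2).trans_eq ?_)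
    ring

/-- The projection of the real line onto `[s, t]`. -/
def clamp (s t x : ℝ) : ℝ := max s (min t x)

theorem clamp_mono (s t : ℝ) {a b : ℝ} (h : a ≤ b) : clamp s t a ≤ clamp s t b :=
  max_le_max le_rfl (min_le_min le_rfl h)

theorem clamp_sub_le (s t : ℝ) {a b : ℝ} (h : a ≤ b) : clamp s t b - clamp s t a ≤ b - a := by
  have h1 : s ≤ clamp s t a := le_max_left _ _
  have h2 : min t a ≤ clamp s t a := le_max_right _ _
  refine sub_le_iff_le_add.2 (max_le (by linarith) ?_)
  rcases le_total t a with h' | h'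
  · rw [min_eq_left h'] at h2
    exact (min_le_left _ _).trans (by linarith)
  · rw [min_eq_right h'] at h2
    exact (min_le_right _ _).trans (by linarith)

theorem clamp_sub_le' {s t : ℝ} (hst : s ≤ t) (a b : ℝ) :
    clamp s t b - clamp s t a ≤ t - s :=
  sub_le_sub (max_le hst (min_le_left _ _)) (le_max_left _ _)

theorem clamp_eq_max {s u : ℝ} (hsu : s ≤ u) (t x : ℝ) :
    clamp u t x = max u (clamp s t x) := by
  rw [clamp, clamp, ← max_assoc, max_eq_left hsu]

theorem clamp_eq_min {s u t : ℝ} (hsu : s ≤ u) (hut : u ≤ t) (x : ℝ) :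
    clamp s u x = min u (clamp s t x) := by
  rw [clamp, clamp, min_max_distrib_left, min_eq_right hsu, ← min_assoc, min_eq_left hut]

theorem mul_clamp_rpow_le {C θ s t a b : ℝ} (hC : 0 ≤ C) (hθ : 0 < θ) (hst : s ≤ t)
    (hab : a ≤ b) : C * (clamp s t b - clamp s t a) ^ (1 + 2 * θ) ≤
      C * (t - s) ^ θ * (b - a) ^ θ * (clamp s t b - clamp s t a) := by
  have hx : 0 ≤ clamp s t b - clamp s t a := sub_nonneg.2 (clamp_mono s t hab)
  rw [show 1 + 2 * θ = θ + θ + 1 by ring, Real.rpow_add_of_nonneg hx (by positivity) zero_le_one,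
    Real.rpow_add_of_nonneg hx hθ.le hθ.le, Real.rpow_one, ← mul_assoc, ← mul_assoc]
  have h1 := clamp_sub_le s t hab
  have h2 := clamp_sub_le' hst a b
  have h3 : 0 ≤ t - s := sub_nonneg.2 hst
  exact mul_le_mul_of_nonneg_right (mul_le_mul (mul_le_mul_of_nonneg_left
    (Real.rpow_le_rpow hx h2 hθ.le) hC) (Real.rpow_le_rpow hx h1 hθ.le) (by positivity)
    (by positivity)) hx

/-- Sewing with a loss in the exponent: an almost additive `F` is close to an additive function.
The latter is the limit of sums over the dyadic partitions of the fixed interval `[0, T]`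
intersected with `[s, t]`. Since the partitions do not depend on `s` and `t`, the limit is
additive. -/
theorem exists_additive_near {F : ℝ → ℝ → ℝ} {C θ : ℝ} (hθ : 0 < θ) (hC : 0 ≤ C)
    (hF0 : ∀ t, F t t = 0)
    (hF : ∀ t u s, s ≤ u → u ≤ t → |F t s - F t u - F u s| ≤ C * (t - s) ^ (1 + 2 * θ))
    (hT : 0 ≤ T) :
    ∃ J : ℝ → ℝ, ∃ K : ℝ, 0 ≤ K ∧ ∀ t s, 0 ≤ s → s ≤ t → t ≤ T →
      |F t s - (J t - J s)| ≤ K * (t - s) ^ (1 + θ) := by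
  set G : ℝ → ℝ → ℝ → ℝ → ℝ := fun s t a b => F (clamp s t b) (clamp s t a) with hGdef
  set S : ℝ → ℝ → ℕ → ℝ := fun s t m => dyadicSum (G s t) m 0 T with hSdef
  -- One factor `θ` of the exponent `1 + 2 * θ` is spent on the mesh, to sum over the levels, and
  -- the other one on `t - s`.
  have hdist : ∀ s t, s ≤ t → ∀ m, dist (S s t m) (S s t (m + 1)) ≤
      C * (t - s) ^ (1 + θ) * T ^ θ * (2⁻¹ ^ θ) ^ m := by
    intro s t hst m
    have h1 : ∀ a b, a ≤ b →
        |G s t a b - (G s t a ((a + b) / 2) + G s t ((a + b) / 2) b)| ≤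
          C * (t - s) ^ θ * (b - a) ^ θ * (clamp s t b - clamp s t a) := by
      intro a b hab
      have ha : clamp s t a ≤ clamp s t ((a + b) / 2) := clamp_mono s t (by linarith)
      have hb : clamp s t ((a + b) / 2) ≤ clamp s t b := clamp_mono s t (by linarith)
      have h2 := hF _ _ _ ha hb
      have e : G s t a b - (G s t a ((a + b) / 2) + G s t ((a + b) / 2) b) =
        F (clamp s t b) (clamp s t a) - F (clamp s t b) (clamp s t ((a + b) / 2)) -
          F (clamp s t ((a + b) / 2)) (clamp s t a) := by simp only [hGdef]; ring
      rw [e]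
      exact h2.trans (mul_clamp_rpow_le hC hθ hst hab)
    have h3 := abs_dyadicSum_le h1 m 0 T hT
    rw [dyadicSum_sub, ← dyadicSum_succ' (G s t)] at h3
    rw [Real.dist_eq]
    refine h3.trans ?_
    have h4 : ((T - 0) / 2 ^ m : ℝ) ^ θ = T ^ θ * (2⁻¹ ^ θ) ^ m := by
      rw [sub_zero, div_eq_mul_inv, Real.mul_rpow hT (by positivity), ← inv_pow,
        ← Real.rpow_natCast, ← Real.rpow_natCast, ← Real.rpow_mul (by norm_num),
        ← Real.rpow_mul (by norm_num), mul_comm (m : ℝ)]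
    have hts : 0 ≤ t - s := by linarith
    rw [h4, Real.rpow_add_of_nonneg hts zero_le_one hθ.le, Real.rpow_one]
    calc _ ≤ C * (t - s) ^ θ * (T ^ θ * (2⁻¹ ^ θ) ^ m) * (t - s) := by
          exact mul_le_mul_of_nonneg_left (clamp_sub_le' hst 0 T) (by positivity)
      _ = _ := by ring
  have hr1 : (2⁻¹ : ℝ) ^ θ < 1 := Real.rpow_lt_one (by norm_num) (by norm_num) hθ
  have hr0 : 0 ≤ (2⁻¹ : ℝ) ^ θ := by positivity
  have hex : ∀ s t, s ≤ t → ∃ I, Filter.Tendsto (S s t) Filter.atTop (nhds I) := fun s t hst =>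
    cauchySeq_tendsto_of_complete (cauchySeq_of_le_geometric _ _ hr1 (hdist s t hst))
  choose! I hI using hex
  -- The dyadic sum of level zero is `F t s` itself, as `[s, t] ⊆ [0, T]`.
  have hclose : ∀ s t, 0 ≤ s → s ≤ t → t ≤ T →
      |F t s - I s t| ≤ C * T ^ θ / (1 - 2⁻¹ ^ θ) * (t - s) ^ (1 + θ) := by
    intro s t hs hst ht
    have h1 := dist_le_of_le_geometric_of_tendsto₀ _ _ hr1 (hdist s t hst) (hI s t hst)
    have h2 : S s t 0 = F t s := by
      have e1 : clamp s t 0 = s := max_eq_left ((min_le_right _ _).trans hs)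
      have e2 : clamp s t T = t := by rw [clamp, min_eq_left ht, max_eq_right hst]
      simp only [hSdef, dyadicSum, hGdef, e1, e2]
    rw [h2, Real.dist_eq] at h1
    refine h1.trans_eq ?_
    ring
  -- Only the partition interval containing `u` contributes to the defect of additivity.
  have hadd : ∀ s u t, s ≤ u → u ≤ t → I s t = I u t + I s u := by
    intro s u t hsu hut
    have hst := hsu.trans hut
    have h1 : ∀ a b, a ≤ b → |G s t a b - (G u t a b - (0 - G s u a b))| ≤
          C * (t - s) ^ θ * (b - a) ^ θ * (clamp s t b - clamp s t a) := by
      intro a b hab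
      have hm := clamp_mono s t hab
      have hx : 0 ≤ clamp s t b - clamp s t a := by linarith
      have h2 : |G s t a b - (G u t a b - (0 - G s u a b))| ≤
          C * (clamp s t b - clamp s t a) ^ (1 + 2 * θ) := by
        have hpos : 0 ≤ C * (clamp s t b - clamp s t a) ^ (1 + 2 * θ) := by positivity
        simp only [hGdef, clamp_eq_max hsu, clamp_eq_min hsu hut]
        generalize clamp s t a = x at *
        generalize clamp s t b = y at *
        rcases le_total u x with h | h
        · have h' := h.trans hm
          simp [max_eq_right h, max_eq_right h', min_eq_left h, min_eq_left h', hF0, hpos]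
        · rcases le_total u y with h' | h'
          · rw [max_eq_left h, max_eq_right h', min_eq_right h, min_eq_left h']
            have := hF y u x h h'
            rwa [show F y x - (F y u - (0 - F u x)) = F y x - F y u - F u x by ring]
          · simp [max_eq_left h, max_eq_left h', min_eq_right h, min_eq_right h', hF0, hpos]
      exact h2.trans (mul_clamp_rpow_le hC hθ hst hab)
    have hzero : ∀ m, dyadicSum (fun _ _ => (0 : ℝ)) m 0 T = 0 := by
      intro m
      have := dyadicSum_sub (fun _ _ => (0 : ℝ)) (fun _ _ => 0) m 0 T
      simpa using this
    have h3 : ∀ m, |S s t m - (S u t m + S s u m)| ≤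
        C * (t - s) ^ θ * ((T - 0) / 2 ^ m) ^ θ * (clamp s t T - clamp s t 0) := by
      intro m
      have := abs_dyadicSum_le h1 m 0 T hT
      rw [dyadicSum_sub (G s t) (fun a b => G u t a b - (0 - G s u a b)),
        dyadicSum_sub (G u t) (fun a b => 0 - G s u a b),
        dyadicSum_sub (fun _ _ => 0) (G s u), hzero] at this
      simpa only [zero_sub, sub_neg_eq_add] using this
    have hl : Filter.Tendsto (fun m : ℕ =>
        C * (t - s) ^ θ * ((T - 0) / 2 ^ m) ^ θ * (clamp s t T - clamp s t 0)) Filter.atTop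
        (nhds (C * (t - s) ^ θ * (0 : ℝ) ^ θ * (clamp s t T - clamp s t 0))) := by
      refine Filter.Tendsto.mul_const _ (Filter.Tendsto.const_mul _ ?_)
      refine Filter.Tendsto.rpow_const ?_ (Or.inr hθ.le)
      simp only [div_eq_mul_inv, ← inv_pow]
      simpa using (tendsto_pow_atTop_nhds_zero_of_lt_one (r := (2⁻¹ : ℝ)) (by norm_num)
        (by norm_num)).const_mul (T - 0)
    have hl2 := ((hI s t hst).sub ((hI u t hut).add (hI s u hsu))).abs
    have := le_of_tendsto_of_tendsto' hl2 hl h3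
    rw [Real.zero_rpow hθ.ne', mul_zero, zero_mul] at this
    have := abs_eq_zero.1 (le_antisymm this (abs_nonneg _))
    linarith
  refine ⟨I 0, C * T ^ θ / (1 - 2⁻¹ ^ θ),
    div_nonneg (by positivity) (by linarith), fun t s hs hst ht => ?_⟩
  have h1 := hclose s t hs hst ht
  have h2 := hadd 0 s t hs hst
  rwa [show I s t = I 0 t - I 0 s by linarith] at h1

/-- The sewing lemma on `[0, T]`, for increments over ordered and unordered pairs of times. -/
theorem exists_sewing (hT : 0 < T) {f : Time T → Time T → ℝ} {C μ : ℝ} (hμ : 1 < μ) (hC : 0 ≤ C)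
    (hf0 : IsIncrement₂ f)
    (hf : ∀ t u s : Time T,
      |coboundary f t u s| ≤ C * max |(t : ℝ) - u| |(u : ℝ) - s| ^ μ) :
    ∃ J : Time T → ℝ, ∃ K : ℝ, 0 ≤ K ∧ ∀ t s : Time T,
      |f t s - (J t - J s)| ≤ K * |(t : ℝ) - s| ^ μ := by
  set P : ℝ → Time T := Set.projIcc 0 T hT.le with hP
  have hPv : ∀ t : Time T, P t = t := fun t => Set.projIcc_val _ t
  set θ := (μ - 1) / 2 with hθ
  have hθ0 : 0 < θ := by rw [hθ]; linarith
  have hF : ∀ t u s : ℝ, s ≤ u → u ≤ t →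
      |f (P t) (P s) - f (P t) (P u) - f (P u) (P s)| ≤ C * (t - s) ^ (1 + 2 * θ) := by
    intro t u s hsu hut
    refine (hf (P t) (P u) (P s)).trans ?_
    rw [show 1 + 2 * θ = μ by rw [hθ]; ring]
    gcongr
    have h1 := Set.abs_projIcc_sub_projIcc (a := (0 : ℝ)) (b := T) hT.le (c := t) (d := u)
    have h2 := Set.abs_projIcc_sub_projIcc (a := (0 : ℝ)) (b := T) hT.le (c := u) (d := s)
    rw [abs_of_nonneg (show 0 ≤ t - u by linarith)] at h1
    rw [abs_of_nonneg (show 0 ≤ u - s by linarith)] at h2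
    exact max_le (h1.trans (by linarith)) (h2.trans (by linarith))
  obtain ⟨J, K, hK, hJ⟩ := exists_additive_near (F := fun t s => f (P t) (P s)) hθ0 hC
    (fun t => hf0 _) hF hT.le
  obtain ⟨D, hD, hDle⟩ := exists_rpow_le_mul_rpow T (μ := μ) (ν := 1 + θ) (by rw [hθ]; linarith)
    (by linarith)
  set g : Time T → Time T → ℝ := fun t s => f t s - (J t - J s) with hg
  have hgle : ∀ t s : Time T, s ≤ t → |g t s| ≤ K * |(t : ℝ) - s| ^ (1 + θ) := by
    intro t s hst
    have := hJ t s s.2.1 hst t.2.2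
    simp only [hPv] at this
    rwa [abs_of_nonneg (show 0 ≤ (t : ℝ) - s from sub_nonneg.2 hst)]
  have hcob : ∀ t u s, coboundary g t u s = coboundary f t u s := by
    intro t u s; simp only [coboundary, hg]; ring
  -- For `t < s` the bound follows from the coboundary at `(s, t, s)`.
  have hrough : ∀ t s : Time T, |g t s| ≤ (K + C * D) * |(t : ℝ) - s| ^ (1 + θ) := by
    intro t s
    rw [add_mul]
    have hpos : 0 ≤ C * D * |(t : ℝ) - s| ^ (1 + θ) := by positivity
    rcases le_total s t with h | h
    · exact (hgle t s h).trans (by linarith)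
    · have h1 := hgle s t h
      have h2 := hf s t s
      rw [← hcob] at h2
      have h3 : g t s = -g s t - coboundary g s t s := by
        have : g s s = 0 := by simp [hg, hf0 s]
        simp only [coboundary, this]; ring
      rw [abs_sub_comm (s : ℝ) t, max_self] at h2
      rw [abs_sub_comm (s : ℝ) t] at h1
      have h4 := mul_le_mul_of_nonneg_left (hDle _ (abs_nonneg _) (abs_sub_le_T t s)) hC
      calc |g t s| ≤ |g s t| + |coboundary g s t s| := by
            rw [h3]; exact (abs_sub _ _).trans (by rw [abs_neg])
        _ ≤ _ := by linarith
  refine ⟨fun t => J t, ((2 : ℝ) ^ μ - 2)⁻¹ * C, ?_, fun t s => ?_⟩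
  · have h2 : (2 : ℝ) < 2 ^ μ := by
      simpa using Real.rpow_lt_rpow_of_exponent_lt (one_lt_two) hμ
    exact mul_nonneg (inv_nonneg.2 (by linarith)) hC
  · refine abs_le_of_coboundary_midTime (g := g) hμ (ν := 1 + θ) (by linarith) hrough
      (fun t s => ?_) hC t s
    rw [hcob]
    have := hf t (midTime t s) s
    rwa [abs_sub_midTime_left, abs_sub_midTime_right, max_self] at this

/-! ### Multiplicative functionals determined by their values on trees -/

/-- The character of the tree algebra obtained by evaluating the functions `x^τ` at `(t, s)`. -/
def charAt (x : LTree L → Time T → Time T → ℝ) (t s : Time T) : TreeAlg L →ₐ[ℝ] ℝ :=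
  MvPolynomial.aeval fun σ => x σ t s

/-- `x^{Δ' τ}_{tus}`, for the multiplicative extension of `x` to forests. -/
def chenTerm (x : LTree L → Time T → Time T → ℝ) (τ : LTree L) (t u s : Time T) : ℝ :=
  Algebra.TensorProduct.productMap (charAt x t u) (charAt x u s) (reducedCoproduct (ofTree τ))

@[simp] theorem charAt_ofTree (x : LTree L → Time T → Time T → ℝ) (t s : Time T) (τ : LTree L) :
    charAt x t s (ofTree τ) = x τ t s := by
  simp [charAt]

theorem charAt_ofForest_zero (x : LTree L → Time T → Time T → ℝ) (t s : Time T) :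
    charAt x t s (ofForest 0) = 1 := by
  rw [ofForest_zero, map_one]

theorem charAt_ofForest_cons (x : LTree L → Time T → Time T → ℝ) (t s : Time T) (τ : LTree L)
    (F : Multiset (LTree L)) :
    charAt x t s (ofForest (τ ::ₘ F)) = x τ t s * charAt x t s (ofForest F) := by
  rw [ofForest_cons, map_mul, charAt_ofTree]

theorem charAt_eq_of_algHom (X : TreeAlg L →ₐ[ℝ] (Time T → Time T → ℝ)) (σ : TreeAlg L)
    (t s : Time T) : X σ t s = charAt (fun τ => X (ofTree τ)) t s σ := by
  have : ((Pi.evalAlgHom ℝ (fun _ : Time T => ℝ) s).comp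
      ((Pi.evalAlgHom ℝ (fun _ : Time T => Time T → ℝ) t).comp X)) =
      charAt (fun τ => X (ofTree τ)) t s :=
    MvPolynomial.algHom_ext fun τ => by simp [charAt]
  exact AlgHom.congr_fun this σ

theorem tensorExt_eq_productMap (X : TreeAlg L →ₐ[ℝ] (Time T → Time T → ℝ))
    (z : TreeAlg L ⊗[ℝ] TreeAlg L) (t u s : Time T) :
    tensorExt X.toLinearMap z t u s =
      Algebra.TensorProduct.productMap (charAt (fun τ => X (ofTree τ)) t u)
        (charAt (fun τ => X (ofTree τ)) u s) z := by
  induction z with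
  | zero => simp
  | add x y hx hy => simp only [map_add, Pi.add_apply, hx, hy]
  | tmul x y =>
    rw [Algebra.TensorProduct.productMap_apply_tmul, ← charAt_eq_of_algHom,
      ← charAt_eq_of_algHom]
    rfl

theorem productMap_multiset_sum (φ ψ : TreeAlg L →ₐ[ℝ] ℝ)
    (M : Multiset (LTree L × Multiset (LTree L))) :
    Algebra.TensorProduct.productMap φ ψ (M.map fun p => ofTree p.1 ⊗ₜ[ℝ] ofForest p.2).sum =
      (M.map fun p => φ (ofTree p.1) * ψ (ofForest p.2)).sum := by
  rw [map_multiset_sum, Multiset.map_map]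
  simp only [Function.comp_def, Algebra.TensorProduct.productMap_apply_tmul]

theorem algHom_ofForest_congr {A : Type*} [CommSemiring A] [Algebra ℝ A]
    {φ ψ : TreeAlg L →ₐ[ℝ] A} {F : Multiset (LTree L)}
    (h : ∀ σ ∈ F, φ (ofTree σ) = ψ (ofTree σ)) : φ (ofForest F) = ψ (ofForest F) := by
  simp only [ofForest, map_multiset_prod, Multiset.map_map]
  exact congrArg _ (Multiset.map_congr rfl h)

/-- `Δ' τ` only involves trees of degree less than `|τ|`. -/
theorem productMap_reducedCoproduct_congr {φ φ' ψ ψ' : TreeAlg L →ₐ[ℝ] ℝ} (τ : LTree L)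
    (hφ : ∀ σ : LTree L, σ.degree < τ.degree → φ (ofTree σ) = φ' (ofTree σ))
    (hψ : ∀ σ : LTree L, σ.degree < τ.degree → ψ (ofTree σ) = ψ' (ofTree σ)) :
    Algebra.TensorProduct.productMap φ ψ (reducedCoproduct (ofTree τ)) =
      Algebra.TensorProduct.productMap φ' ψ' (reducedCoproduct (ofTree τ)) := by
  obtain ⟨M, hM, eM⟩ := reducedCoproduct_ofTree_eq_sum τ
  rw [eM, productMap_multiset_sum, productMap_multiset_sum]
  refine congrArg _ (Multiset.map_congr rfl fun p hp => ?_)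
  obtain ⟨h0, hd⟩ := hM p hp
  have h1 := forestDegree_pos h0
  have h2 := p.1.degree_pos
  rw [hφ _ (by omega), algHom_ofForest_congr fun σ hσ => hψ σ ?_]
  have := degree_le_forestDegree hσ
  omega

theorem chenTerm_congr {x y : LTree L → Time T → Time T → ℝ} (τ : LTree L)
    (h : ∀ σ : LTree L, σ.degree < τ.degree → x σ = y σ) : chenTerm x τ = chenTerm y τ := by
  funext t u s
  exact productMap_reducedCoproduct_congr τ (fun σ hσ => by simp [h σ hσ])
    (fun σ hσ => by simp [h σ hσ])

theorem conv_charAt_ofTree (x : LTree L → Time T → Time T → ℝ) (τ : LTree L) (t u s : Time T) :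
    conv (charAt x t u) (charAt x u s) (ofTree τ) = x τ t u + x τ u s + chenTerm x τ t u s := by
  rw [conv_apply_eq_reducedCoproduct, charAt_ofTree, charAt_ofTree, chenTerm]

theorem conv_charAt_eq_of_chen {x : LTree L → Time T → Time T → ℝ} {τ : LTree L}
    (h : coboundary (x τ) = chenTerm x τ) (t u s : Time T) :
    conv (charAt x t u) (charAt x u s) (ofTree τ) = charAt x t s (ofTree τ) := by
  rw [conv_charAt_ofTree, ← h, charAt_ofTree, coboundary]
  ring

/-- If Chen's relation holds on all trees of degree less than `|τ|`, then `x^{Δ' τ}` is closed.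
This is coassociativity, evaluated at the tree `τ` itself. -/
theorem chenTerm_cocycle {x : LTree L → Time T → Time T → ℝ} {τ : LTree L} (h0 : x τ = 0)
    (h : ∀ σ : LTree L, σ.degree < τ.degree → coboundary (x σ) = chenTerm x σ)
    (t v u s : Time T) :
    chenTerm x τ t u s + chenTerm x τ t v u = chenTerm x τ t v s + chenTerm x τ v u s := by
  have key := AlgHom.congr_fun
    (conv_assoc (charAt x t v) (charAt x v u) (charAt x u s)) (ofTree τ)
  rw [conv_apply_eq_reducedCoproduct (conv _ _), conv_charAt_ofTree,
    conv_apply_eq_reducedCoproduct (charAt x t v) (conv _ _), conv_charAt_ofTree,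
    productMap_reducedCoproduct_congr (φ' := charAt x t u) (ψ' := charAt x u s) τ
      (fun σ hσ => conv_charAt_eq_of_chen (h σ hσ) t v u) (fun _ _ => rfl),
    productMap_reducedCoproduct_congr (φ' := charAt x t v) (ψ' := charAt x v s) τ
      (fun _ _ => rfl) (fun σ hσ => conv_charAt_eq_of_chen (h σ hσ) v u s)] at key
  simp only [charAt_ofTree, h0, Pi.zero_apply] at key
  simp only [chenTerm] at key ⊢
  linarith

/-- Chen's relation extends from trees to the whole algebra. -/
theorem coboundary_eq_tensorExt_of_chen {X : TreeAlg L →ₐ[ℝ] (Time T → Time T → ℝ)}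
    (h : ∀ τ, coboundary (X (ofTree τ)) = chenTerm (fun τ => X (ofTree τ)) τ) (σ : TreeAlg L) :
    coboundary (X σ) = tensorExt X.toLinearMap (reducedCoproduct σ) := by
  funext t u s
  have h1 : conv (charAt (fun τ => X (ofTree τ)) t u) (charAt (fun τ => X (ofTree τ)) u s) =
      charAt (fun τ => X (ofTree τ)) t s :=
    MvPolynomial.algHom_ext fun τ => conv_charAt_eq_of_chen (h τ) t u s
  have h2 := AlgHom.congr_fun h1 σ
  rw [conv_apply_eq_reducedCoproduct] at h2
  rw [tensorExt_eq_productMap, coboundary, charAt_eq_of_algHom, charAt_eq_of_algHom X σ t u,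
    charAt_eq_of_algHom X σ u s, ← h2]
  ring

/-! ### Bounds on forests -/

theorem exists_bound_multiset_sum {ι α : Type*} (M : Multiset ι) (a : ι → α → ℝ) (w : α → ℝ)
    (h : ∀ p ∈ M, ∃ C : ℝ, 0 ≤ C ∧ ∀ z, |a p z| ≤ C * w z) :
    ∃ C : ℝ, 0 ≤ C ∧ ∀ z, |(M.map fun p => a p z).sum| ≤ C * w z := by
  induction M using Multiset.induction_on with
  | empty => exact ⟨0, le_rfl, by simp⟩
  | cons p M ih =>
    obtain ⟨C, hC, h1⟩ := ih fun q hq => h q (Multiset.mem_cons_of_mem hq)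
    obtain ⟨D, hD, h2⟩ := h p (Multiset.mem_cons_self _ _)
    refine ⟨D + C, by positivity, fun z => ?_⟩
    rw [Multiset.map_cons, Multiset.sum_cons, add_mul]
    exact (abs_add_le _ _).trans (add_le_add (h2 z) (h1 z))

theorem exists_bound_charAt_ofForest {x : LTree L → Time T → Time T → ℝ} {F : Multiset (LTree L)}
    (h : ∀ σ ∈ F, ∃ C : ℝ, 0 ≤ C ∧ ∀ t s, |x σ t s| ≤ C) :
    ∃ C : ℝ, 0 ≤ C ∧ ∀ t s, |charAt x t s (ofForest F)| ≤ C := by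
  induction F using Multiset.induction_on with
  | empty => exact ⟨1, zero_le_one, fun t s => by rw [charAt_ofForest_zero, abs_one]⟩
  | cons τ F ih =>
    obtain ⟨C, hC, h1⟩ := ih fun q hq => h q (Multiset.mem_cons_of_mem hq)
    obtain ⟨D, hD, h2⟩ := h τ (Multiset.mem_cons_self _ _)
    refine ⟨D * C, by positivity, fun t s => ?_⟩
    rw [charAt_ofForest_cons, abs_mul]
    exact mul_le_mul (h2 t s) (h1 t s) (abs_nonneg _) hD

theorem exists_bound_charAt_ofForest_sub {x y : LTree L → Time T → Time T → ℝ} {μ : ℝ}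
    {F : Multiset (LTree L)}
    (hx : ∀ σ ∈ F, ∃ C : ℝ, 0 ≤ C ∧ ∀ t s, |x σ t s| ≤ C)
    (hy : ∀ σ ∈ F, ∃ C : ℝ, 0 ≤ C ∧ ∀ t s, |y σ t s| ≤ C)
    (hxy : ∀ σ ∈ F, ∃ C : ℝ, 0 ≤ C ∧
      ∀ t s : Time T, |x σ t s - y σ t s| ≤ C * |(t : ℝ) - s| ^ μ) :
    ∃ C : ℝ, 0 ≤ C ∧ ∀ t s : Time T,
      |charAt x t s (ofForest F) - charAt y t s (ofForest F)| ≤ C * |(t : ℝ) - s| ^ μ := by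
  induction F using Multiset.induction_on with
  | empty => exact ⟨0, le_rfl, fun t s => by simp [charAt_ofForest_zero]⟩
  | cons τ F ih =>
    obtain ⟨C, hC, h1⟩ := ih (fun q hq => hx q (Multiset.mem_cons_of_mem hq))
      (fun q hq => hy q (Multiset.mem_cons_of_mem hq))
      (fun q hq => hxy q (Multiset.mem_cons_of_mem hq))
    obtain ⟨D, hD, h2⟩ := hxy τ (Multiset.mem_cons_self _ _)
    obtain ⟨E, hE, h3⟩ := hy τ (Multiset.mem_cons_self _ _)
    obtain ⟨K, hK, h4⟩ :=
      exists_bound_charAt_ofForest fun q hq => hx q (Multiset.mem_cons_of_mem hq)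
    refine ⟨D * K + E * C, by positivity, fun t s => ?_⟩
    rw [charAt_ofForest_cons, charAt_ofForest_cons,
      show ∀ a b c d : ℝ, a * b - c * d = (a - c) * b + c * (b - d) by intros; ring]
    refine (abs_add_le _ _).trans ?_
    rw [abs_mul, abs_mul]
    calc _ ≤ D * |(t : ℝ) - s| ^ μ * K + E * (C * |(t : ℝ) - s| ^ μ) :=
          add_le_add (mul_le_mul (h2 t s) (h4 t s) (abs_nonneg _) (by positivity))
            (mul_le_mul (h3 t s) (h1 t s) (abs_nonneg _) hE)
      _ = _ := by ring

/-- If `x` and `y` are bounded and close of order `μ` on trees of lower degree, then so are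
`x^{Δ' τ}` and `y^{Δ' τ}`: every term of `Δ' τ` contributes a difference times a bounded
factor. -/
theorem exists_bound_chenTerm_sub {x y : LTree L → Time T → Time T → ℝ} {μ : ℝ} (hμ : 0 ≤ μ)
    {τ : LTree L}
    (hx : ∀ σ : LTree L, σ.degree < τ.degree → ∃ C : ℝ, 0 ≤ C ∧ ∀ t s, |x σ t s| ≤ C)
    (hy : ∀ σ : LTree L, σ.degree < τ.degree → ∃ C : ℝ, 0 ≤ C ∧ ∀ t s, |y σ t s| ≤ C)
    (hxy : ∀ σ : LTree L, σ.degree < τ.degree → ∃ C : ℝ, 0 ≤ C ∧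
      ∀ t s : Time T, |x σ t s - y σ t s| ≤ C * |(t : ℝ) - s| ^ μ) :
    ∃ C : ℝ, 0 ≤ C ∧ ∀ t u s : Time T, |chenTerm x τ t u s - chenTerm y τ t u s| ≤
      C * max |(t : ℝ) - u| |(u : ℝ) - s| ^ μ := by
  obtain ⟨M, hM, eM⟩ := reducedCoproduct_ofTree_eq_sum τ
  have hterm : ∀ p ∈ M, ∃ C : ℝ, 0 ≤ C ∧ ∀ z : Time T × Time T × Time T,
      |x p.1 z.1 z.2.1 * charAt x z.2.1 z.2.2 (ofForest p.2) -
        y p.1 z.1 z.2.1 * charAt y z.2.1 z.2.2 (ofForest p.2)| ≤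
      C * max |(z.1 : ℝ) - z.2.1| |(z.2.1 : ℝ) - z.2.2| ^ μ := by
    intro p hp
    obtain ⟨hp0, hpd⟩ := hM p hp
    have h1 := forestDegree_pos hp0
    have h2 := p.1.degree_pos
    have hlt : ∀ σ ∈ p.2, σ.degree < τ.degree := fun σ hσ => by
      have := degree_le_forestDegree hσ
      omega
    obtain ⟨C, hC, h3⟩ := hxy p.1 (by omega)
    obtain ⟨D, hD, h4⟩ := hy p.1 (by omega)
    obtain ⟨E, hE, h5⟩ := exists_bound_charAt_ofForest fun σ hσ => hx σ (hlt σ hσ)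
    obtain ⟨K, hK, h6⟩ := exists_bound_charAt_ofForest_sub (fun σ hσ => hx σ (hlt σ hσ))
      (fun σ hσ => hy σ (hlt σ hσ)) (fun σ hσ => hxy σ (hlt σ hσ))
    refine ⟨C * E + D * K, by positivity, ?_⟩
    rintro ⟨t, u, s⟩
    dsimp only
    rw [show ∀ a b c d : ℝ, a * b - c * d = (a - c) * b + c * (b - d) by intros; ring]
    refine (abs_add_le _ _).trans ?_
    rw [abs_mul, abs_mul]
    have hm : 0 ≤ max |(t : ℝ) - u| |(u : ℝ) - s| := (abs_nonneg _).trans (le_max_left _ _)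
    have h7 : |x p.1 t u - y p.1 t u| ≤ C * max |(t : ℝ) - u| |(u : ℝ) - s| ^ μ :=
      (h3 t u).trans (mul_le_mul_of_nonneg_left
        (Real.rpow_le_rpow (abs_nonneg _) (le_max_left _ _) hμ) hC)
    have h8 := (h6 u s).trans (mul_le_mul_of_nonneg_left
        (Real.rpow_le_rpow (abs_nonneg _) (le_max_right |(t : ℝ) - u| |(u : ℝ) - s|) hμ) hK)
    calc _ ≤ C * max |(t : ℝ) - u| |(u : ℝ) - s| ^ μ * E +
          D * (K * max |(t : ℝ) - u| |(u : ℝ) - s| ^ μ) :=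
          add_le_add (mul_le_mul h7 (h5 u s) (abs_nonneg _) (by positivity))
            (mul_le_mul (h4 t u) h8 (abs_nonneg _) hD)
      _ = _ := by ring
  obtain ⟨C, hC, h⟩ := exists_bound_multiset_sum M
    (fun p (z : Time T × Time T × Time T) =>
      x p.1 z.1 z.2.1 * charAt x z.2.1 z.2.2 (ofForest p.2) -
        y p.1 z.1 z.2.1 * charAt y z.2.1 z.2.2 (ofForest p.2)) _ hterm
  refine ⟨C, hC, fun t u s => ?_⟩
  have := h (t, u, s)
  rw [Multiset.sum_map_sub] at this
  rw [chenTerm, chenTerm, eM, productMap_multiset_sum, productMap_multiset_sum]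
  simpa only [charAt_ofTree] using this

/-! ### Construction of the multiplicative functional -/

/-- `g` is an admissible value at the tree `τ` of a multiplicative functional which is close to
`y` of order `μ` and given by `x` on trees of degree less than `|τ|`. -/
structure IsLift (μ : ℝ) (y x : LTree L → Time T → Time T → ℝ) (τ : LTree L)
    (g : Time T → Time T → ℝ) : Prop where
  chen : coboundary g = chenTerm x τ
  close : ∃ C : ℝ, 0 ≤ C ∧ ∀ t s : Time T, |g t s - y τ t s| ≤ C * |(t : ℝ) - s| ^ μ

theorem IsLift.isIncrement {μ : ℝ} (hμ : 1 < μ) {y x : LTree L → Time T → Time T → ℝ}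
    {τ : LTree L} {g : Time T → Time T → ℝ} (h : IsLift μ y x τ g)
    (hy : IsIncrement₂ (y τ)) : IsIncrement₂ g := by
  intro t
  obtain ⟨C, -, hC⟩ := h.close
  have := hC t t
  rw [hy t, sub_self, abs_zero, Real.zero_rpow (by linarith), mul_zero, sub_zero] at this
  exact abs_eq_zero.1 (le_antisymm this (abs_nonneg _))

/-- One step of the construction. The closed `x^{Δ' τ}` is the coboundary of
`f_{ts} = - x^{Δ' τ}_{ts0}`, and sewing `f - y^τ` gives the additive correction to `f`. -/
theorem exists_isLift (hT : 0 < T) {μ : ℝ} (hμ : 1 < μ) {y x : LTree L → Time T → Time T → ℝ}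
    {τ : LTree L} (hy0 : ∀ σ, IsIncrement₂ (y σ))
    (hyb : ∀ σ, ∃ C : ℝ, 0 ≤ C ∧ ∀ t s, |y σ t s| ≤ C)
    (hyR : ∃ C : ℝ, 0 ≤ C ∧ ∀ t u s : Time T, |coboundary (y τ) t u s - chenTerm y τ t u s| ≤
      C * max |(t : ℝ) - u| |(u : ℝ) - s| ^ μ)
    (hx0 : x τ = 0)
    (hx : ∀ σ : LTree L, σ.degree < τ.degree → IsLift μ y x σ (x σ)) :
    ∃ g, IsLift μ y x τ g := by
  have hxb : ∀ σ : LTree L, σ.degree < τ.degree → ∃ C : ℝ, 0 ≤ C ∧ ∀ t s, |x σ t s| ≤ C := by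
    intro σ hσ
    obtain ⟨C, hC, h1⟩ := (hx σ hσ).close
    obtain ⟨D, hD, h2⟩ := hyb σ
    refine ⟨C * T ^ μ + D, by positivity, fun t s => ?_⟩
    rw [show x σ t s = (x σ t s - y σ t s) + y σ t s by ring]
    refine (abs_add_le _ _).trans (add_le_add ((h1 t s).trans ?_) (h2 t s))
    exact mul_le_mul_of_nonneg_left (Real.rpow_le_rpow (abs_nonneg _) (abs_sub_le_T t s)
      (by linarith)) hC
  obtain ⟨C, hC, h1⟩ := exists_bound_chenTerm_sub (by linarith : 0 ≤ μ) hxb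
    (fun σ _ => hyb σ) (fun σ hσ => (hx σ hσ).close)
  obtain ⟨D, hD, h2⟩ := hyR
  set o : Time T := ⟨0, le_rfl, hT.le⟩
  set f : Time T → Time T → ℝ := fun t s => -chenTerm x τ t s o with hf
  have hfδ : coboundary f = chenTerm x τ := by
    funext t v u
    have := chenTerm_cocycle hx0 (fun σ hσ => (hx σ hσ).chen) t v u o
    simp only [coboundary, hf]
    linarith
  have hf0 : ∀ t, f t t = 0 := by
    intro t
    obtain ⟨M, hM, eM⟩ := reducedCoproduct_ofTree_eq_sum τ
    simp only [hf, chenTerm]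
    rw [eM, productMap_multiset_sum, neg_eq_zero]
    refine Multiset.sum_eq_zero fun r hr => ?_
    obtain ⟨p, hp, rfl⟩ := Multiset.mem_map.1 hr
    have h3 := forestDegree_pos (hM p hp).1
    have h4 := (hM p hp).2
    rw [charAt_ofTree, (hx p.1 (by omega)).isIncrement hμ (hy0 p.1) t, zero_mul]
  obtain ⟨J, K, hK, hJ⟩ := exists_sewing hT (f := f - y τ) hμ (add_nonneg hC hD)
    (fun t => by simp [hf0 t, hy0 τ t]) (fun t u s => by
      have e : coboundary (f - y τ) t u s = (chenTerm x τ t u s - chenTerm y τ t u s) -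
          (coboundary (y τ) t u s - chenTerm y τ t u s) := by
        rw [← hfδ]; simp only [coboundary, Pi.sub_apply]; ring
      rw [e, add_mul]
      exact (abs_sub _ _).trans (add_le_add (h1 t u s) (h2 t u s)))
  refine ⟨fun t s => f t s - (J t - J s), ?_, K, hK, fun t s => ?_⟩
  · rw [← hfδ]
    funext t u s
    simp only [coboundary]
    ring
  · have := hJ t s
    simp only [Pi.sub_apply] at this
    rwa [show f t s - (J t - J s) - y τ t s = f t s - y τ t s - (J t - J s) by ring]

/-- The multiplicative functional close to `y`, chosen tree by tree along the degree. The test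
on degrees only serves to make the recursion well-founded. -/
def multLift (μ : ℝ) (y : LTree L → Time T → Time T → ℝ) (τ : LTree L) : Time T → Time T → ℝ :=
  Classical.epsilon (IsLift μ y (fun σ => if _h : σ.degree < τ.degree then multLift μ y σ else 0) τ)
termination_by τ.degree

/-- Every bounded, almost multiplicative `y` has a multiplicative functional close to it. -/
theorem isLift_multLift (hT : 0 < T) {μ : ℝ} (hμ : 1 < μ) {y : LTree L → Time T → Time T → ℝ}
    (hy0 : ∀ σ, IsIncrement₂ (y σ))
    (hyb : ∀ σ, ∃ C : ℝ, 0 ≤ C ∧ ∀ t s, |y σ t s| ≤ C)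
    (hyR : ∀ σ, ∃ C : ℝ, 0 ≤ C ∧ ∀ t u s : Time T,
      |coboundary (y σ) t u s - chenTerm y σ t u s| ≤
        C * max |(t : ℝ) - u| |(u : ℝ) - s| ^ μ) (τ : LTree L) :
    IsLift μ y (multLift μ y) τ (multLift μ y τ) := by
  induction hd : τ.degree using Nat.strong_induction_on generalizing τ with
  | _ d ih =>
  subst hd
  set x : LTree L → Time T → Time T → ℝ :=
    fun σ => if _h : σ.degree < τ.degree then multLift μ y σ else 0 with hx
  have hlow : ∀ σ : LTree L, σ.degree < τ.degree → x σ = multLift μ y σ :=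
    fun σ hσ => by simp only [hx, dif_pos hσ]
  have hex : ∃ g, IsLift μ y x τ g := by
    refine exists_isLift hT hμ hy0 hyb (hyR τ) (by simp [hx]) fun σ hσ => ?_
    obtain ⟨h1, h2⟩ := ih _ hσ σ rfl
    rw [hlow σ hσ]
    refine ⟨?_, h2⟩
    rw [h1]
    exact chenTerm_congr σ fun ρ hρ => (hlow ρ (hρ.trans hσ)).symm
  have hspec := Classical.epsilon_spec hex
  rw [multLift]
  exact ⟨hspec.chen.trans (chenTerm_congr τ hlow), hspec.close⟩

/-! ### The bound by `q_γ` -/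

theorem qTree_nonneg (γ : ℝ) (τ : LTree L) : 0 ≤ qTree γ τ := by
  induction hd : τ.degree using Nat.strong_induction_on generalizing τ with
  | _ d ih =>
  subst hd
  rcases le_or_gt (γ * τ.degree) 1 with h | h
  · rw [qTree_of_le γ τ h]; exact zero_le_one
  · obtain ⟨M, hM, eM⟩ := reducedCoproduct_ofTree_eq_sum τ
    rw [qTree_of_lt γ τ h, eM, productMap_multiset_sum]
    have h2 : (2 : ℝ) < 2 ^ (γ * τ.degree) := by
      simpa using Real.rpow_lt_rpow_of_exponent_lt (one_lt_two) h
    refine mul_nonneg (inv_nonneg.2 (by linarith)) (Multiset.sum_nonneg fun r hr => ?_)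
    obtain ⟨p, hp, rfl⟩ := Multiset.mem_map.1 hr
    obtain ⟨h0, hdeg⟩ := hM p hp
    have h3 := forestDegree_pos h0
    have h4 := p.1.degree_pos
    refine mul_nonneg ?_ ?_
    · rw [MvPolynomial.aeval_X]; exact ih _ (by omega) p.1 rfl
    · simp only [ofForest, map_multiset_prod, Multiset.map_map]
      refine Multiset.prod_nonneg fun r hr => ?_
      obtain ⟨σ, hσ, rfl⟩ := Multiset.mem_map.1 hr
      simp only [Function.comp_apply, MvPolynomial.aeval_X]
      have := degree_le_forestDegree hσ
      exact ih _ (by omega) σ rfl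

theorem qForest_nonneg (γ : ℝ) (F : Multiset (LTree L)) : 0 ≤ qForest γ F :=
  Multiset.prod_nonneg fun r hr => by
    obtain ⟨σ, -, rfl⟩ := Multiset.mem_map.1 hr
    exact qTree_nonneg γ σ

theorem aeval_qTree_ofForest (γ : ℝ) (F : Multiset (LTree L)) :
    MvPolynomial.aeval (qTree γ) (ofForest F) = qForest γ F := by
  simp [ofForest, qForest, map_multiset_prod, Multiset.map_map]

/-- A family of bounds `c_σ |t - s|^(γ|σ|)` for the trees of a forest multiplies up. -/
theorem abs_charAt_ofForest_le {x : LTree L → Time T → Time T → ℝ} {γ : ℝ} (hγ : 0 ≤ γ)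
    {c : LTree L → ℝ} {F : Multiset (LTree L)} (hc : ∀ σ ∈ F, 0 ≤ c σ)
    (h : ∀ σ ∈ F, ∀ t s : Time T, |x σ t s| ≤ c σ * |(t : ℝ) - s| ^ (γ * σ.degree))
    (t s : Time T) : |charAt x t s (ofForest F)| ≤
      (F.map c).prod * |(t : ℝ) - s| ^ (γ * forestDegree F) := by
  induction F using Multiset.induction_on with
  | empty => simp [charAt_ofForest_zero, forestDegree_zero]
  | cons τ F ih =>
    have h1 := ih (fun σ hσ => hc σ (Multiset.mem_cons_of_mem hσ))
      (fun σ hσ => h σ (Multiset.mem_cons_of_mem hσ))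
    have h2 := h τ (Multiset.mem_cons_self _ _) t s
    have h3 := hc τ (Multiset.mem_cons_self _ _)
    rw [charAt_ofForest_cons, abs_mul, forestDegree_cons, Nat.cast_add, mul_add,
      Real.rpow_add_of_nonneg (abs_nonneg _) (by positivity) (by positivity), Multiset.map_cons,
      Multiset.prod_cons]
    calc _ ≤ c τ * |(t : ℝ) - s| ^ (γ * τ.degree) *
          ((F.map c).prod * |(t : ℝ) - s| ^ (γ * forestDegree F)) :=
          mul_le_mul h2 h1 (abs_nonneg _) (by positivity)
      _ = _ := by ring

theorem prod_map_pow_mul_qTree (A γ : ℝ) (F : Multiset (LTree L)) :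
    (F.map fun σ => A ^ σ.degree * qTree γ σ).prod = A ^ forestDegree F * qForest γ F := by
  induction F using Multiset.induction_on with
  | empty => simp [forestDegree, qForest]
  | cons τ F ih =>
    rw [Multiset.map_cons, Multiset.prod_cons, ih, forestDegree_cons, pow_add]
    simp only [qForest, Multiset.map_cons, Multiset.prod_cons]
    ring

/-- The growth of a multiplicative functional is controlled by `q_γ`. For `γ|τ| ≤ 1` this is the
choice of `A`. For `γ|τ| > 1` the recursion defining `q_γ` matches the sharp constant of the
sewing lemma, as at a midpoint every term `σ ⊗ H` of `Δ' τ` contributes a multiple of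
`(|t - s| / 2)^(γ|σ| + γ|H|)`. -/
theorem abs_le_pow_mul_qTree {x : LTree L → Time T → Time T → ℝ} {γ A : ℝ} (hγ : 0 < γ)
    (hA : 0 ≤ A) (hchen : ∀ τ, coboundary (x τ) = chenTerm x τ)
    (hsmall : ∀ τ : LTree L, γ * τ.degree ≤ 1 → ∀ t s : Time T,
      |x τ t s| ≤ A ^ τ.degree * |(t : ℝ) - s| ^ (γ * τ.degree))
    (hlarge : ∀ τ : LTree L, 1 < γ * τ.degree → ∃ ν K : ℝ, 1 < ν ∧ ∀ t s : Time T,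
      |x τ t s| ≤ K * |(t : ℝ) - s| ^ ν) (τ : LTree L) (t s : Time T) :
    |x τ t s| ≤ A ^ τ.degree * qTree γ τ * |(t : ℝ) - s| ^ (γ * τ.degree) := by
  induction hd : τ.degree using Nat.strong_induction_on generalizing τ t s with
  | _ d ih =>
  subst hd
  rcases le_or_gt (γ * τ.degree) 1 with h | h
  · rw [qTree_of_le γ τ h, mul_one]; exact hsmall τ h t s
  · obtain ⟨ν, K, hν, hK⟩ := hlarge τ h
    obtain ⟨M, hM, eM⟩ := reducedCoproduct_ofTree_eq_sum τ
    have hq : ∀ σ : LTree L, 0 ≤ A ^ σ.degree * qTree γ σ := fun σ =>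
      mul_nonneg (pow_nonneg hA _) (qTree_nonneg γ σ)
    have hterm : ∀ p ∈ M, ∀ t u s : Time T, ∀ r : ℝ, |(t : ℝ) - u| = r → |(u : ℝ) - s| = r →
        |x p.1 t u * charAt x u s (ofForest p.2)| ≤
          A ^ τ.degree * r ^ (γ * τ.degree) * (qTree γ p.1 * qForest γ p.2) := by
      rintro p hp t u s r hr1 hr2
      have hr0 : 0 ≤ r := hr1 ▸ abs_nonneg _
      obtain ⟨h0, hdeg⟩ := hM p hp
      have h3 := forestDegree_pos h0
      have h4 := p.1.degree_pos
      have h5 := ih _ (by omega) p.1 t u rfl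
      have h6 := abs_charAt_ofForest_le (x := x) hγ.le (F := p.2) (fun σ _ => hq σ)
        (fun σ hσ t s => ih _ (by have := degree_le_forestDegree hσ; omega) σ t s rfl) u s
      rw [prod_map_pow_mul_qTree, hr2] at h6
      rw [hr1] at h5
      rw [abs_mul, ← hdeg, Nat.cast_add, mul_add, pow_add,
        Real.rpow_add_of_nonneg hr0 (by positivity) (by positivity)]
      have h7 := hq p.1
      refine (mul_le_mul h5 h6 (abs_nonneg _) (by positivity)).trans_eq ?_
      ring
    set Q : ℝ := (M.map fun p => qTree γ p.1 * qForest γ p.2).sum with hQ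
    have hQ0 : 0 ≤ Q := Multiset.sum_nonneg fun r hr => by
      obtain ⟨p, -, rfl⟩ := Multiset.mem_map.1 hr
      exact mul_nonneg (qTree_nonneg γ _) (qForest_nonneg γ _)
    have hqτ : qTree γ τ = ((2 : ℝ) ^ (γ * τ.degree) - 2)⁻¹ * Q := by
      rw [qTree_of_lt γ τ h, eM, productMap_multiset_sum, hQ]
      simp only [MvPolynomial.aeval_X, aeval_qTree_ofForest]
    have hmid : ∀ t s : Time T, |coboundary (x τ) t (midTime t s) s| ≤
        A ^ τ.degree * Q * (|(t : ℝ) - s| / 2) ^ (γ * τ.degree) := by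
      intro t s
      rw [hchen, chenTerm, eM, productMap_multiset_sum]
      refine (Multiset.abs_sum_le_sum_abs).trans ?_
      rw [Multiset.map_map, mul_right_comm, hQ, ← Multiset.sum_map_mul_left]
      refine Multiset.sum_map_le_sum_map _ _ fun p hp => ?_
      simp only [Function.comp_apply, charAt_ofTree]
      exact hterm p hp t (midTime t s) s _ (abs_sub_midTime_left t s) (abs_sub_midTime_right t s)
    have := abs_le_of_coboundary_midTime h hν hK hmid (by positivity) t s
    refine this.trans_eq ?_
    rw [hqτ]
    ring

/-! ### Existence and uniqueness -/

theorem IsBranchedRoughPath.exists_bound_ofTree {γ : ℝ}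
    {X : TreeAlg L →ₐ[ℝ] (Time T → Time T → ℝ)} (hX : IsBranchedRoughPath γ X) (τ : LTree L) :
    ∃ C : ℝ, 0 ≤ C ∧ ∀ t s : Time T,
      |X (ofTree τ) t s| ≤ C * |(t : ℝ) - s| ^ (γ * τ.degree) := by
  obtain ⟨A, B, -, -, -, h⟩ := hX.bound
  have := h {τ}
  rw [forestDegree_singleton, ofForest_singleton] at this
  exact norm₂_lt_top_iff.1 (this.trans_lt ENNReal.ofReal_lt_top)

theorem exists_abs_sub_le {g₁ g₂ : Time T → Time T → ℝ} {μ₁ μ₂ C₁ C₂ : ℝ} (hμ₁ : 1 < μ₁)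
    (hμ₂ : 1 < μ₂) (hC₁ : 0 ≤ C₁) (hC₂ : 0 ≤ C₂)
    (h₁ : ∀ t s : Time T, |g₁ t s| ≤ C₁ * |(t : ℝ) - s| ^ μ₁)
    (h₂ : ∀ t s : Time T, |g₂ t s| ≤ C₂ * |(t : ℝ) - s| ^ μ₂) :
    ∃ K : ℝ, ∀ t s : Time T, |g₁ t s - g₂ t s| ≤ K * |(t : ℝ) - s| ^ min μ₁ μ₂ := by
  have hpos : 0 < min μ₁ μ₂ := lt_min (by linarith) (by linarith)
  obtain ⟨D₁, -, hD₁⟩ := exists_rpow_le_mul_rpow T (min_le_left μ₁ μ₂) hpos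
  obtain ⟨D₂, -, hD₂⟩ := exists_rpow_le_mul_rpow T (min_le_right μ₁ μ₂) hpos
  refine ⟨C₁ * D₁ + C₂ * D₂, fun t s => (abs_sub _ _).trans ?_⟩
  have e₁ := mul_le_mul_of_nonneg_left (hD₁ _ (abs_nonneg _) (abs_sub_le_T t s)) hC₁
  have e₂ := mul_le_mul_of_nonneg_left (hD₂ _ (abs_nonneg _) (abs_sub_le_T t s)) hC₂
  linarith [h₁ t s, h₂ t s]

theorem one_lt_mul_degree {n : ℕ} {γ : ℝ} (hγ : 1 / ((n : ℝ) + 1) < γ) {d : ℕ} (hd : n < d) :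
    1 < ((n : ℝ) + 1) * γ ∧ ((n : ℝ) + 1) * γ ≤ γ * d := by
  have h1 : (0 : ℝ) < n + 1 := by positivity
  have h2 : 0 < γ := lt_trans (by positivity) hγ
  have h3 : ((n : ℝ) + 1) ≤ d := by exact_mod_cast hd
  rw [div_lt_iff₀ h1] at hγ
  constructor <;> nlinarith

/-- Two branched rough paths which are close to the same functional on trees of degree at most
`n` agree: by induction on the degree their difference is additive and of order `> 1`. -/
theorem IsBranchedRoughPath.eq_of_close {n : ℕ} {γ : ℝ} (hγ : 1 / ((n : ℝ) + 1) < γ)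
    {X₁ X₂ : TreeAlg L →ₐ[ℝ] (Time T → Time T → ℝ)} {Y : LTree L → Time T → Time T → ℝ}
    (h₁ : IsBranchedRoughPath γ X₁) (h₂ : IsBranchedRoughPath γ X₂)
    (hY₁ : ∀ τ : LTree L, τ.degree ≤ n → MemC₂OnePlus (X₁ (ofTree τ) - Y τ))
    (hY₂ : ∀ τ : LTree L, τ.degree ≤ n → MemC₂OnePlus (X₂ (ofTree τ) - Y τ)) : X₁ = X₂ := by
  refine MvPolynomial.algHom_ext fun τ => ?_
  change X₁ (ofTree τ) = X₂ (ofTree τ)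
  induction hd : τ.degree using Nat.strong_induction_on generalizing τ with
  | _ d ih =>
  subst hd
  obtain ⟨K, ν, hν, hK⟩ : ∃ K ν : ℝ, 1 < ν ∧ ∀ t s : Time T,
      |(X₁ (ofTree τ) - X₂ (ofTree τ)) t s| ≤ K * |(t : ℝ) - s| ^ ν := by
    rcases le_or_gt τ.degree n with h | h
    · obtain ⟨μ₁, hμ₁, -, hn₁⟩ := hY₁ τ h
      obtain ⟨μ₂, hμ₂, -, hn₂⟩ := hY₂ τ h
      obtain ⟨C₁, hC₁, hb₁⟩ := norm₂_lt_top_iff.1 hn₁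
      obtain ⟨C₂, hC₂, hb₂⟩ := norm₂_lt_top_iff.1 hn₂
      obtain ⟨K, hK⟩ := exists_abs_sub_le hμ₁ hμ₂ hC₁ hC₂ hb₁ hb₂
      exact ⟨K, _, lt_min hμ₁ hμ₂, fun t s => by simpa using hK t s⟩
    · obtain ⟨C₁, hC₁, hb₁⟩ := h₁.exists_bound_ofTree τ
      obtain ⟨C₂, hC₂, hb₂⟩ := h₂.exists_bound_ofTree τ
      have hg := one_lt_mul_degree hγ h
      have hg' := hg.1.trans_le hg.2
      obtain ⟨K, hK⟩ := exists_abs_sub_le hg' hg' hC₁ hC₂ hb₁ hb₂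
      exact ⟨K, _, lt_min hg' hg', hK⟩
  -- `Δ' τ` involves only smaller trees, on which the two paths agree.
  have hδ : ∀ t u s, coboundary (X₁ (ofTree τ) - X₂ (ofTree τ)) t u s = 0 := by
    intro t u s
    have e₁ := congrFun (congrFun (congrFun (h₁.multiplicative (ofTree τ)) t) u) s
    have e₂ := congrFun (congrFun (congrFun (h₂.multiplicative (ofTree τ)) t) u) s
    rw [tensorExt_eq_productMap] at e₁ e₂
    rw [productMap_reducedCoproduct_congr τ
      (φ' := charAt (fun τ => X₂ (ofTree τ)) t u) (ψ' := charAt (fun τ => X₂ (ofTree τ)) u s)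
      (fun σ hσ => by simp only [charAt_ofTree]; rw [ih _ hσ σ rfl])
      (fun σ hσ => by simp only [charAt_ofTree]; rw [ih _ hσ σ rfl]), ← e₂] at e₁
    simp only [coboundary, Pi.sub_apply] at e₁ ⊢
    linarith
  funext t s
  have := abs_le_of_coboundary_midTime (μ := 2) (M := 0) (by norm_num) hν hK
    (fun t s => by rw [hδ]; simp) le_rfl t s
  rw [mul_zero, zero_mul] at this
  have := abs_eq_zero.1 (le_antisymm this (abs_nonneg _))
  exact sub_eq_zero.1 this

theorem IsPartialHom.map_ofForest {n : ℕ} {X' : TreeAlg L →ₗ[ℝ] (Time T → Time T → ℝ)}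
    (h : IsPartialHom n X') {y : LTree L → Time T → Time T → ℝ}
    (hy : ∀ τ : LTree L, τ.degree ≤ n → y τ = X' (ofTree τ)) {F : Multiset (LTree L)}
    (hF : forestDegree F ≤ n) (t s : Time T) :
    X' (ofForest F) t s = charAt y t s (ofForest F) := by
  induction F using Multiset.induction_on with
  | empty => rw [charAt_ofForest_zero, ofForest_zero, h.map_one]; rfl
  | cons τ F ih =>
    rw [forestDegree_cons] at hF
    have h1 := h.map_mul {τ} F (by rw [forestDegree_add, forestDegree_singleton]; exact hF)
    rw [← Multiset.singleton_add, h1, Pi.mul_apply, Pi.mul_apply, ih (by omega),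
      Multiset.singleton_add, charAt_ofForest_cons, hy τ (by omega), ofForest_singleton]

theorem IsPartialHom.remainder_apply {n : ℕ} {X' : TreeAlg L →ₗ[ℝ] (Time T → Time T → ℝ)}
    (h : IsPartialHom n X') {y : LTree L → Time T → Time T → ℝ}
    (hy : ∀ τ : LTree L, τ.degree ≤ n → y τ = X' (ofTree τ)) {τ : LTree L}
    (hτ : τ.degree ≤ n) (t u s : Time T) :
    remainder X' τ t u s = coboundary (y τ) t u s - chenTerm y τ t u s := by
  obtain ⟨M, hM, eM⟩ := reducedCoproduct_ofTree_eq_sum τ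
  rw [remainder, Pi.sub_apply, Pi.sub_apply, Pi.sub_apply, chenTerm, eM, productMap_multiset_sum,
    hy τ hτ, map_multiset_sum, Multiset.map_map]
  congr 1
  have heval : ∀ N : Multiset (Time T → Time T → Time T → ℝ),
      N.sum t u s = (N.map fun g => g t u s).sum := by
    intro N
    induction N using Multiset.induction_on with
    | empty => simp
    | cons g N ih => simp [ih]
  rw [heval, Multiset.map_map]
  refine congrArg _ (Multiset.map_congr rfl fun p hp => ?_)
  obtain ⟨h0, hdeg⟩ := hM p hp
  change X' (ofTree p.1) t u * X' (ofForest p.2) u s = _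
  rw [h.map_ofForest hy (by omega), ← hy p.1 (by omega), charAt_ofTree]

/-- Existence, quantitatively: if the defects are of order `μ`, then so is the distance from the
branched rough path. The functional is extended by zero to trees of degree above `n`, where
the defect has order `(n + 1) γ > 1` for the trivial reason that it is a sum of products of total
order `γ|τ|`. -/
theorem exists_isBranchedRoughPath [Finite L] (hT : 0 < T) {n : ℕ} {γ μ : ℝ}
    {X' : TreeAlg L →ₗ[ℝ] (Time T → Time T → ℝ)} (hX' : IsAlmostBranchedRoughPath n γ X')
    (hμ : 1 < μ) (hμn : μ ≤ ((n : ℝ) + 1) * γ)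
    (hR : ∀ τ : LTree L, τ.degree ≤ n → ∃ C : ℝ, 0 ≤ C ∧ ∀ t u s : Time T,
      |remainder X' τ t u s| ≤ C * max |(t : ℝ) - u| |(u : ℝ) - s| ^ μ) :
    ∃ X : TreeAlg L →ₐ[ℝ] (Time T → Time T → ℝ), IsBranchedRoughPath γ X ∧
      ∀ τ : LTree L, τ.degree ≤ n → MemC₂ μ (X (ofTree τ) - X' (ofTree τ)) := by
  classical
  have hγ : 0 < γ := lt_trans (by positivity) hX'.roughness
  set y : LTree L → Time T → Time T → ℝ :=
    fun τ => if τ.degree ≤ n then X' (ofTree τ) else 0 with hy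
  have hyn : ∀ τ : LTree L, τ.degree ≤ n → y τ = X' (ofTree τ) := fun τ h => by
    simp only [hy, if_pos h]
  have hyn' : ∀ τ : LTree L, n < τ.degree → y τ = 0 := fun τ h => by
    simp only [hy, if_neg h.not_ge]
  have hy0 : ∀ τ, IsIncrement₂ (y τ) := by
    intro τ
    rcases le_or_gt τ.degree n with h | h
    · rw [hyn τ h]; exact hX'.partialHom.increment τ h
    · rw [hyn' τ h]; intro t; rfl
  have hyh : ∃ K : ℝ, 0 ≤ K ∧ ∀ (τ : LTree L) (t s : Time T),
      |y τ t s| ≤ K * |(t : ℝ) - s| ^ (γ * τ.degree) := by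
    obtain ⟨K, hK⟩ := hX'.bound
    refine ⟨max K 0, le_max_right _ _, fun τ t s => ?_⟩
    rcases le_or_gt τ.degree n with h | h
    · rw [hyn τ h]
      exact (norm₂_le_iff (le_max_right _ _)).1
        ((hK τ h).trans (ENNReal.ofReal_le_ofReal (le_max_left _ _))) t s
    · rw [hyn' τ h]
      simp only [Pi.zero_apply, abs_zero]
      positivity
  obtain ⟨K, hK, hyK⟩ := hyh
  have hyb : ∀ τ, ∃ C : ℝ, 0 ≤ C ∧ ∀ t s, |y τ t s| ≤ C := fun τ =>
    ⟨K * T ^ (γ * τ.degree), by positivity, fun t s => (hyK τ t s).trans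
      (mul_le_mul_of_nonneg_left (Real.rpow_le_rpow (abs_nonneg _) (abs_sub_le_T t s)
        (by positivity)) hK)⟩
  have hyR : ∀ τ, ∃ C : ℝ, 0 ≤ C ∧ ∀ t u s : Time T,
      |coboundary (y τ) t u s - chenTerm y τ t u s| ≤
        C * max |(t : ℝ) - u| |(u : ℝ) - s| ^ μ := by
    intro τ
    rcases le_or_gt τ.degree n with h | h
    · obtain ⟨C, hC, h1⟩ := hR τ h
      exact ⟨C, hC, fun t u s => by
        rw [← hX'.partialHom.remainder_apply hyn h]; exact h1 t u s⟩
    · obtain ⟨M, hM, eM⟩ := reducedCoproduct_ofTree_eq_sum τ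
      have hg := (one_lt_mul_degree hX'.roughness h).2
      obtain ⟨D, hD, hDle⟩ := exists_rpow_le_mul_rpow T (hμn.trans hg) (by linarith)
      obtain ⟨C, hC, h1⟩ := exists_bound_multiset_sum M
        (fun p (z : Time T × Time T × Time T) =>
          y p.1 z.1 z.2.1 * charAt y z.2.1 z.2.2 (ofForest p.2))
        (fun z => max |(z.1 : ℝ) - z.2.1| |(z.2.1 : ℝ) - z.2.2| ^ μ) (by
          intro p hp
          have hK' : 0 ≤ (p.2.map fun _ => K).prod := Multiset.prod_nonneg fun r hr => by
            obtain ⟨σ, -, rfl⟩ := Multiset.mem_map.1 hr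
            exact hK
          refine ⟨K * (p.2.map fun _ => K).prod * D, by positivity, ?_⟩
          rintro ⟨t, u, s⟩
          dsimp only
          set m := max |(t : ℝ) - u| |(u : ℝ) - s|
          have hm : 0 ≤ m := (abs_nonneg _).trans (le_max_left _ _)
          have h2 : |y p.1 t u| ≤ K * m ^ (γ * p.1.degree) := (hyK p.1 t u).trans
            (mul_le_mul_of_nonneg_left (Real.rpow_le_rpow (abs_nonneg _) (le_max_left _ _)
              (by positivity)) hK)
          have h3 : |charAt y u s (ofForest p.2)| ≤
              (p.2.map fun _ => K).prod * m ^ (γ * forestDegree p.2) :=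
            (abs_charAt_ofForest_le hγ.le (fun _ _ => hK) (fun σ _ => hyK σ) u s).trans
              (mul_le_mul_of_nonneg_left (Real.rpow_le_rpow (abs_nonneg _) (le_max_right _ _)
                (by positivity)) hK')
          have h4 := hDle m hm (max_le (abs_sub_le_T _ _) (abs_sub_le_T _ _))
          rw [← (hM p hp).2, Nat.cast_add, mul_add,
            Real.rpow_add_of_nonneg hm (by positivity) (by positivity)] at h4
          rw [abs_mul]
          calc _ ≤ K * m ^ (γ * p.1.degree) *
                ((p.2.map fun _ => K).prod * m ^ (γ * forestDegree p.2)) :=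
                mul_le_mul h2 h3 (abs_nonneg _) (by positivity)
            _ = K * (p.2.map fun _ => K).prod *
                (m ^ (γ * p.1.degree) * m ^ (γ * forestDegree p.2)) := by ring
            _ ≤ K * (p.2.map fun _ => K).prod * (D * m ^ μ) :=
                mul_le_mul_of_nonneg_left h4 (by positivity)
            _ = _ := by ring)
      refine ⟨C, hC, fun t u s => ?_⟩
      have h2 := h1 (t, u, s)
      have h3 : coboundary (y τ) t u s = 0 := by rw [hyn' τ h]; simp [coboundary]
      rw [h3, zero_sub, abs_neg, chenTerm, eM, productMap_multiset_sum]
      simpa only [charAt_ofTree] using h2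
  have hlift := isLift_multLift hT hμ hy0 hyb hyR
  set x := multLift μ y with hx
  set X : TreeAlg L →ₐ[ℝ] (Time T → Time T → ℝ) := MvPolynomial.aeval x with hXdef
  have hXx : (fun τ => X (ofTree τ)) = x := by funext τ; simp [hXdef]
  have hXτ : ∀ τ, X (ofTree τ) = x τ := fun τ => by simp [hXdef]
  have hx0 : ∀ τ, IsIncrement₂ (x τ) := fun τ => (hlift τ).isIncrement hμ (hy0 τ)
  -- The Hölder exponent of `x^τ` is the smaller one of those of `y^τ` and of `x^τ - y^τ`.
  have hxh : ∀ (τ : LTree L) (ν : ℝ), 0 < ν → ν ≤ γ * τ.degree → ν ≤ μ →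
      ∃ C : ℝ, 0 ≤ C ∧ ∀ t s : Time T, |x τ t s| ≤ C * |(t : ℝ) - s| ^ ν := by
    intro τ ν hν0 hν1 hν2
    obtain ⟨C, hC, h1⟩ := (hlift τ).close
    obtain ⟨D, hD, h2⟩ := exists_rpow_le_mul_rpow T hν1 hν0
    obtain ⟨E, hE, h3⟩ := exists_rpow_le_mul_rpow T hν2 hν0
    refine ⟨C * E + K * D, by positivity, fun t s => ?_⟩
    have e1 := mul_le_mul_of_nonneg_left (h3 _ (abs_nonneg _) (abs_sub_le_T t s)) hC
    have e2 := mul_le_mul_of_nonneg_left (h2 _ (abs_nonneg _) (abs_sub_le_T t s)) hK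
    rw [show x τ t s = (x τ t s - y τ t s) + y τ t s by ring]
    refine (abs_add_le _ _).trans ?_
    linarith [h1 t s, hyK τ t s]
  obtain ⟨A, hA1, hA⟩ : ∃ A : ℝ, 1 ≤ A ∧ ∀ τ : LTree L, γ * τ.degree ≤ 1 → ∀ t s : Time T,
      |x τ t s| ≤ A ^ τ.degree * |(t : ℝ) - s| ^ (γ * τ.degree) := by
    have hfin : {τ : LTree L | γ * τ.degree ≤ 1}.Finite := by
      refine (LTree.finite_degree_le ⌊1 / γ⌋₊).subset fun τ h => ?_
      refine Nat.le_floor ?_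
      rw [le_div_iff₀ hγ, mul_comm]
      exact h
    have hc : ∀ τ : LTree L, ∃ c : ℝ, γ * τ.degree ≤ 1 → ∀ t s : Time T,
        |x τ t s| ≤ c * |(t : ℝ) - s| ^ (γ * τ.degree) := by
      intro τ
      by_cases h : γ * τ.degree ≤ 1
      · have := τ.degree_pos
        obtain ⟨c, -, hc⟩ := hxh τ (γ * τ.degree) (by positivity) le_rfl (by linarith)
        exact ⟨c, fun _ => hc⟩
      · exact ⟨0, fun h' => absurd h' h⟩
    choose c hc using hc
    obtain ⟨A, hA⟩ := (hfin.image c).bddAbove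
    refine ⟨max A 1, le_max_right _ _, fun τ h t s => (hc τ h t s).trans ?_⟩
    refine mul_le_mul_of_nonneg_right ?_ (by positivity)
    calc c τ ≤ max A 1 := (hA ⟨τ, h, rfl⟩).trans (le_max_left _ _)
      _ ≤ _ := le_self_pow₀ (le_max_right _ _) τ.degree_pos.ne'
  have hbound := abs_le_pow_mul_qTree hγ (zero_le_one.trans hA1) (fun τ => (hlift τ).chen) hA
    (fun τ h => by
      obtain ⟨C, -, hC⟩ := hxh τ (min (γ * τ.degree) μ) (lt_min (by linarith) (by linarith))
        (min_le_left _ _) (min_le_right _ _)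
      exact ⟨_, C, lt_min h hμ, hC⟩)
  refine ⟨X, ⟨fun τ => by rw [hXτ]; exact hx0 τ, ?_, A, 1, by linarith, zero_le_one, le_rfl, ?_⟩,
    fun τ h => ⟨fun t => ?_, ?_⟩⟩
  · refine coboundary_eq_tensorExt_of_chen fun τ => ?_
    rw [hXx, hXτ]
    exact (hlift τ).chen
  · intro F
    have hq : ∀ σ : LTree L, 0 ≤ A ^ σ.degree * qTree γ σ := fun σ =>
      mul_nonneg (by positivity) (qTree_nonneg γ σ)
    refine (norm₂_le_iff (mul_nonneg (by positivity) (qForest_nonneg γ F))).2 fun t s => ?_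
    rw [charAt_eq_of_algHom, hXx, one_mul, ← prod_map_pow_mul_qTree]
    exact abs_charAt_ofForest_le hγ.le (fun σ _ => hq σ) (fun σ _ => hbound σ) t s
  · rw [hXτ, ← hyn τ h]
    simp [hx0 τ t, hy0 τ t]
  · rw [hXτ, ← hyn τ h]
    exact norm₂_lt_top_iff.2 (hlift τ).close

end BRP

end

theorem mainTheorem3 {L : Type*} [Finite L] {T : ℝ} (hT : 0 < T) (n : ℕ) (γ : ℝ)
    (X' : BRP.TreeAlg L →ₗ[ℝ] (BRP.Time T → BRP.Time T → ℝ))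
    (hX' : BRP.IsAlmostBranchedRoughPath n γ X') :
    (∃! X : BRP.TreeAlg L →ₐ[ℝ] (BRP.Time T → BRP.Time T → ℝ),
      BRP.IsBranchedRoughPath γ X ∧
        ∀ τ : BRP.LTree L, τ.degree ≤ n →
          BRP.MemC₂OnePlus (X (BRP.ofTree τ) - X' (BRP.ofTree τ))) ∧
    ((∀ τ : BRP.LTree L, τ.degree ≤ n →
        BRP.MemC₃ (((n : ℝ) + 1) * γ) (BRP.remainder X' τ)) →
      ∃! X : BRP.TreeAlg L →ₐ[ℝ] (BRP.Time T → BRP.Time T → ℝ),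
        BRP.IsBranchedRoughPath γ X ∧
          (⨆ τ : {τ : BRP.LTree L // τ.degree ≤ n},
            BRP.norm₂ (((n : ℝ) + 1) * γ)
              (X (BRP.ofTree τ.1) - X' (BRP.ofTree τ.1))) < (⊤ : ENNReal)) := by
  have hγn : 1 < ((n : ℝ) + 1) * γ := (BRP.one_lt_mul_degree hX'.roughness n.lt_succ_self).1
  have hfin := BRP.LTree.finite_degree_le (L := L) n
  constructor
  · -- A common order `μ > 1` for the finitely many defects.
    have hc : ∀ τ : BRP.LTree L, ∃ μ : ℝ, 1 < μ ∧ (τ.degree ≤ n →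
        BRP.MemC₃ μ (BRP.remainder X' τ)) := by
      intro τ
      by_cases h : τ.degree ≤ n
      · obtain ⟨μ, hμ, h'⟩ := hX'.almost_multiplicative τ h
        exact ⟨μ, hμ, fun _ => h'⟩
      · exact ⟨2, one_lt_two, fun h' => absurd h' h⟩
    choose m hm1 hm using hc
    obtain ⟨μ, hμ1, hμn, hμ⟩ : ∃ μ : ℝ, 1 < μ ∧ μ ≤ ((n : ℝ) + 1) * γ ∧
        ∀ τ : BRP.LTree L, τ.degree ≤ n → μ ≤ m τ := by
      have hfin' := (hfin.image m).insert (((n : ℝ) + 1) * γ)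
      obtain ⟨μ, hμ, hle⟩ := Set.exists_min_image _ id hfin' ⟨_, Set.mem_insert _ _⟩
      refine ⟨μ, ?_, hle _ (Set.mem_insert _ _),
        fun τ h => hle _ (Set.mem_insert_of_mem _ ⟨τ, h, rfl⟩)⟩
      rcases hμ with rfl | ⟨τ, -, rfl⟩
      · exact hγn
      · exact hm1 τ
    obtain ⟨X, hX, hclose⟩ := BRP.exists_isBranchedRoughPath hT hX' hμ1 hμn fun τ h => by
      obtain ⟨C, hC, h1⟩ := BRP.exists_bound_of_norm₃_lt_top (hm τ h).2
      obtain ⟨D, hD, h2⟩ := BRP.exists_rpow_le_mul_rpow T (hμ τ h) (by linarith)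
      refine ⟨C * D, by positivity, fun t u s => (h1 t u s).trans ?_⟩
      rw [mul_assoc]
      exact mul_le_mul_of_nonneg_left (h2 _ ((abs_nonneg _).trans (le_max_left _ _))
        (max_le (BRP.abs_sub_le_T _ _) (BRP.abs_sub_le_T _ _))) hC
    exact ⟨X, ⟨hX, fun τ h => ⟨μ, hμ1, hclose τ h⟩⟩, fun X₂ h₂ =>
      BRP.IsBranchedRoughPath.eq_of_close hX'.roughness h₂.1 hX h₂.2
        fun τ h => ⟨μ, hμ1, hclose τ h⟩⟩
  · intro hR
    obtain ⟨X, hX, hclose⟩ := BRP.exists_isBranchedRoughPath hT hX' hγn le_rfl fun τ h =>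
      BRP.exists_bound_of_norm₃_lt_top (hR τ h).2
    refine ⟨X, ⟨hX, ?_⟩, fun X₂ h₂ =>
      BRP.IsBranchedRoughPath.eq_of_close hX'.roughness h₂.1 hX (fun τ h => ?_)
        fun τ h => ⟨_, hγn, hclose τ h⟩⟩
    · have : Finite {τ : BRP.LTree L // τ.degree ≤ n} := hfin
      rcases isEmpty_or_nonempty {τ : BRP.LTree L // τ.degree ≤ n} with _ | _
      · simp
      · obtain ⟨τ, hτ⟩ := exists_eq_ciSup_of_finite
          (f := fun τ : {τ : BRP.LTree L // τ.degree ≤ n} =>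
            BRP.norm₂ (((n : ℝ) + 1) * γ) (X (BRP.ofTree τ.1) - X' (BRP.ofTree τ.1)))
        rw [← hτ]
        exact (hclose τ.1 τ.2).2
    · refine ⟨_, hγn, fun t => ?_, (le_iSup (fun τ : {τ : BRP.LTree L // τ.degree ≤ n} =>
        BRP.norm₂ (((n : ℝ) + 1) * γ) (X₂ (BRP.ofTree τ.1) - X' (BRP.ofTree τ.1)))
        ⟨τ, h⟩).trans_lt h₂.2⟩
      simp [h₂.1.increment τ t, hX'.partialHom.increment τ h t]
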